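/- Let $n\ge 3$, $M\in\mathbb Z$, let $p\in\mathbb C^\times$ with $|p|\neq 1$, and let $\kappa\in\mathbb C$ satisfy $\kappa^n=p^{-1}$. For $i,j\in\mathbb Z/n$ let $a_{ij}$ be the entries of the Cartan matrix of type $A^{(1)}_{n-1}$, and let $m_{i,i+1}=-1$, $m_{i,i-1}=1$ and $m_{ij}=0$ otherwise. The toroidal algebra $U'(\mathfrak{sl}_{n,tor})$ at $q=1$ is the unital associative $\mathbb C$-algebra generated by $E_{i,k},F_{i,k},H_{i,k}$ $(i\in\mathbb Z/n,\ k\in\mathbb Z)$ and a central element $c$, with relations $$[H_{i,k},H_{j,l}]=\delta_{k+l,0}\,k\,a_{ij}\kappa^{-km_{ij}}c,\qquad [H_{i,k},E_{j,l}]=a_{ij}\kappa^{-km_{ij}}E_{j,k+l},\qquad [H_{i,k},F_{j,l}]=-a_{ij}\kappa^{-km_{ij}}F_{j,k+l},$$ $$[E_{i,k},F_{j,l}]=\delta_{ij}\,(H_{i,k+l}+\delta_{k+l,0}\,k\,c),\qquad \kappa^{m_{ij}}[X_{i,k+1},X_{j,l}]=[X_{i,k},X_{j,l+1}],$$ $$[X_{i,k},X_{j,l}]=0\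 \text{ if } a_{ij}=0,\qquad [X_{i,k_1},[X_{i,k_2},X_{j,l}]]+[X_{i,k_2},[X_{i,k_1},X_{j,l}]]=0\ \text{ if } a_{ij}=-1\qquad (X=E,F).$$ Put $\mathbf e_0=[F_{n-1,0},[\dots,[F_{2,0},F_{1,1}]\dots]]$ and $\mathbf f_0=[\dots[E_{1,-1},E_{2,0}],\dots,E_{n-1,0}]$. Let $V(z)=\mathbb C[z^{\pm1}]\otimes\mathbb C^n$ with basis $u_k=z^mv_\epsilon$, $k=\epsilon-nm$, $1\le\epsilon\le n$. Let $E^{a,b}$ be the matrix units acting on $\mathbb C^n$, and let $p^{\pm D}z^mv_\epsilon=p^{\pm m}z^mv_\epsilon$. Let $F_M$ be the Fock space at $q=1$: the span of the semi-infinite wedges $u_{k_1}\wedge u_{k_2}\wedge\cdots$ with $k_i=M-i+1$ for $i\gg1$, which are antisymmetric in adjacent factors. Let $|M\rangle=u_M\wedge u_{M-1}\wedge\cdots$. For an operator $X$ on $V(z)$ let $X_j$ denote its action on the $j$-th factor. Then $F_M$ carries an action of $U'(\mathfrak{sl}_{n,tor})$ such that $$E_{i,0}=\sum_jE_j^{i,i+1},\quad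 F_{i,0}=\sum_jE_j^{i+1,i}\quad(1\le i\le n-1),\qquad E_{0,0}=\sum_jz_jE_j^{n,1},\quad F_{0,0}=\sum_jz_j^{-1}E_j^{1,n},$$ $$\mathbf e_0=\sum_jp^{-D_j}E_j^{n,1},\qquad \mathbf f_0=\sum_jp^{D_j}E_j^{1,n},\qquad c=0,\qquad H_{i,0}|M\rangle=\delta(M\equiv i\bmod n)\,|M\rangle\quad(0\le i\le n-1),$$ where on each wedge only finitely many terms of each sum are nonzero. For every such action, $F_M$ is an irreducible $U'(\mathfrak{sl}_{n,tor})$-module. -/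

import Mathlib

namespace ToroidalFock

/-! ### The toroidal algebra at `q = 1` -/

/-- The entry `⟨h_i, α_j⟩` of the Cartan matrix of type `A_{n-1}^{(1)}`; for `n ≥ 3`. -/
def cartan (n : ℕ) (i j : ZMod n) : ℤ :=
  if i = j then 2 else if j = i + 1 ∨ i = j + 1 then -1 else 0

/-- The entry `m_{ij}` of the antisymmetric matrix with `m_{i,i+1} = -1` and `m_{i,i-1} = 1`
(indices mod `n`, other entries `0`); for `n ≥ 3`. -/
def mMat (n : ℕ) (i j : ZMod n) : ℤ :=
  if j = i + 1 then -1 else if i = j + 1 then 1 else 0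

/-- Generators `E_{i,k}`, `F_{i,k}`, `H_{i,k}` (`i ∈ ℤ/n`, `k ∈ ℤ`, where `H_{i,0} = H_i`) and `c`.
At `q = 1` the pair `K_i^±` is replaced by `H_i = lim (K_i^+ - K_i^-)/(q - q⁻¹)` and `q^{c/2}` by
its logarithm `c`. The degree generators are absent. -/
inductive Gen (n : ℕ) : Type
  | E (i : ZMod n) (k : ℤ)
  | F (i : ZMod n) (k : ℤ)
  | H (i : ZMod n) (k : ℤ)
  | c

/-- The free algebra on the generators. -/
abbrev Free (n : ℕ) : Type := FreeAlgebra ℂ (Gen n)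

/-- A generator as an element of the free algebra. -/
def gen {n : ℕ} (g : Gen n) : Free n := FreeAlgebra.ι ℂ g

/-- The defining relations at `q = 1`. Each one is the coefficient form of the `q = 1` limit of
the corresponding relation between the currents `E_i(z) = ∑ E_{i,k} z^{-k}`,
`F_i(z) = ∑ F_{i,k} z^{-k}` and `K_i^±(z)`; `⁅x, y⁆ = x * y - y * x`. -/
inductive TorRel (n : ℕ) (κ : ℂ) : Free n → Free n → Prop
  /-- `c` is central. -/
  | central (g : Gen n) : TorRel n κ ⁅gen (n := n) .c, gen (n := n) g⁆ 0
  | HH (i j : ZMod n) (k l : ℤ) :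
      TorRel n κ ⁅gen (n := n) (.H i k), gen (n := n) (.H j l)⁆
        (if k + l = 0 then
          (((k * cartan n i j : ℤ) : ℂ) * κ ^ (-(k * mMat n i j))) • gen (n := n) .c else 0)
  | HE (i j : ZMod n) (k l : ℤ) :
      TorRel n κ ⁅gen (n := n) (.H i k), gen (n := n) (.E j l)⁆
        (((cartan n i j : ℂ) * κ ^ (-(k * mMat n i j))) • gen (n := n) (.E j (k + l)))
  | HF (i j : ZMod n) (k l : ℤ) :
      TorRel n κ ⁅gen (n := n) (.H i k), gen (n := n) (.F j l)⁆
        ((-(cartan n i j : ℂ) * κ ^ (-(k * mMat n i j))) • gen (n := n) (.F j (k + l)))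
  | EF (i j : ZMod n) (k l : ℤ) :
      TorRel n κ ⁅gen (n := n) (.E i k), gen (n := n) (.F j l)⁆
        (if i = j then
          gen (n := n) (.H i (k + l)) + (if k + l = 0 then (k : ℂ) • gen (n := n) .c else 0) else 0)
  /-- `(κ^{m_{ij}} z - w) [E_i(z), E_j(w)] = 0`. -/
  | EE (i j : ZMod n) (k l : ℤ) :
      TorRel n κ (κ ^ mMat n i j • ⁅gen (n := n) (.E i (k + 1)), gen (n := n) (.E j l)⁆)
        ⁅gen (n := n) (.E i k), gen (n := n) (.E j (l + 1))⁆
  /-- `(κ^{m_{ij}} z - w) [F_i(z), F_j(w)] = 0`. -/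
  | FF (i j : ZMod n) (k l : ℤ) :
      TorRel n κ (κ ^ mMat n i j • ⁅gen (n := n) (.F i (k + 1)), gen (n := n) (.F j l)⁆)
        ⁅gen (n := n) (.F i k), gen (n := n) (.F j (l + 1))⁆
  /-- Serre relations for nodes that are not adjacent. -/
  | serreE₁ (i j : ZMod n) (h : cartan n i j = 0) (k l : ℤ) :
      TorRel n κ ⁅gen (n := n) (.E i k), gen (n := n) (.E j l)⁆ 0
  | serreF₁ (i j : ZMod n) (h : cartan n i j = 0) (k l : ℤ) :
      TorRel n κ ⁅gen (n := n) (.F i k), gen (n := n) (.F j l)⁆ 0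
  /-- Serre relations for adjacent nodes, symmetrized in the two spectral parameters. -/
  | serreE₂ (i j : ZMod n) (h : cartan n i j = -1) (k₁ k₂ l : ℤ) :
      TorRel n κ (⁅gen (n := n) (.E i k₁), ⁅gen (n := n) (.E i k₂), gen (n := n) (.E j l)⁆⁆
        + ⁅gen (n := n) (.E i k₂), ⁅gen (n := n) (.E i k₁), gen (n := n) (.E j l)⁆⁆) 0
  | serreF₂ (i j : ZMod n) (h : cartan n i j = -1) (k₁ k₂ l : ℤ) :
      TorRel n κ (⁅gen (n := n) (.F i k₁), ⁅gen (n := n) (.F i k₂), gen (n := n) (.F j l)⁆⁆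
        + ⁅gen (n := n) (.F i k₂), ⁅gen (n := n) (.F i k₁), gen (n := n) (.F j l)⁆⁆) 0

/-- The toroidal algebra `U'(sl_{n,tor})` with parameter `κ`, at `q = 1`. -/
abbrev Tor (n : ℕ) (κ : ℂ) : Type := RingQuot (TorRel n κ)

/-- The class of a generator in the toroidal algebra. -/
def tor (n : ℕ) (κ : ℂ) (g : Gen n) : Tor n κ := RingQuot.mkAlgHom ℂ (TorRel n κ) (gen g)

/-- `[⋯[[E_{1,-1}, E_{2,0}], E_{3,0}], ⋯, E_{r+1,0}]`. -/
def nestE (n : ℕ) (κ : ℂ) : ℕ → Tor n κ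
  | 0 => tor n κ (.E 1 (-1))
  | r + 1 => ⁅nestE n κ r, tor n κ (.E ((r + 2 : ℕ) : ZMod n) 0)⁆

/-- `[F_{r+1,0}, [⋯, [F_{3,0}, [F_{2,0}, F_{1,1}]]⋯]]`. -/
def nestF (n : ℕ) (κ : ℂ) : ℕ → Tor n κ
  | 0 => tor n κ (.F 1 1)
  | r + 1 => ⁅tor n κ (.F ((r + 2 : ℕ) : ZMod n) 0), nestF n κ r⁆

/-- The Chevalley generator `𝐞₀` of the vertical subalgebra (the copy of `U'(sl_n^)` generated
by `E_{i,k}`, `F_{i,k}`, `H_{i,k}`, `c` with `1 ≤ i ≤ n - 1`). Its other Chevalley generators are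
`𝐞_i = E_{i,0}`, `𝐟_i = F_{i,0}`. -/
def vertE0 (n : ℕ) (κ : ℂ) : Tor n κ := nestF n κ (n - 2)

/-- The Chevalley generator `𝐟₀` of the vertical subalgebra. -/
def vertF0 (n : ℕ) (κ : ℂ) : Tor n κ := nestE n κ (n - 2)

/-! ### The space `V(z) = ℂ[z^{±1}] ⊗ ℂⁿ` and its operators -/

/-- `V(z)`, with its basis `u_k = z^m v_ε`, where `k = ε - n m`, `1 ≤ ε ≤ n`. -/
abbrev Vz : Type := ℤ →₀ ℂ

/-- The basis vector `u_k`. -/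
noncomputable def u (k : ℤ) : Vz := Finsupp.single k 1

/-- The index `ε ∈ {1, …, n}` with `u_k = z^m v_ε`. -/
def eps (n : ℕ) (k : ℤ) : ℤ := (k - 1) % n + 1

/-- The exponent `m` with `u_k = z^m v_ε`. -/
def lev (n : ℕ) (k : ℤ) : ℤ := -((k - 1) / n)

/-- Defining property of `ε` and `m`. -/
theorem eps_sub_lev (n : ℕ) (hn : 0 < n) (k : ℤ) :
    1 ≤ eps n k ∧ eps n k ≤ n ∧ k = eps n k - n * lev n k := by
  have hn' : (0 : ℤ) < n := by exact_mod_cast hn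
  have h1 := Int.emod_nonneg (k - 1) hn'.ne'
  have h2 := Int.emod_lt_of_pos (k - 1) hn'
  have h3 := Int.emod_add_mul_ediv (k - 1) n
  unfold eps lev
  refine ⟨by linarith, by linarith, by linarith⟩

/-- Multiplication by `z^r`. -/
noncomputable def zPow (n : ℕ) (r : ℤ) : Module.End ℂ Vz :=
  Finsupp.linearCombination ℂ fun k => u (k - n * r)

/-- The matrix unit `E^{a,b}`, `1 ≤ a, b ≤ n`: `z^m v_b ↦ z^m v_a`, `z^m v_ε ↦ 0` for `ε ≠ b`. -/
noncomputable def matUnit (n : ℕ) (a b : ℤ) : Module.End ℂ Vz :=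
  Finsupp.linearCombination ℂ fun k => if eps n k = b then u (k + a - b) else 0

/-- The difference operator `p^{rD}`: `z^m v_ε ↦ p^{r m} z^m v_ε`. -/
noncomputable def pD (n : ℕ) (p : ℂ) (r : ℤ) : Module.End ℂ Vz :=
  Finsupp.linearCombination ℂ fun k => p ^ (r * lev n k) • u k

/-! ### The Fock space at `q = 1` -/

/-- Index sequences of the pure tensors `u_{k_0} ⊗ u_{k_1} ⊗ ⋯` with `k_i = M - i` for `i ≫ 0`
(positions are counted from `0`). -/
def Seq (M : ℤ) : Type := {k : ℕ → ℤ // ∀ᶠ i : ℕ in Filter.atTop, k i = M - i}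

/-- Replace the factor in position `j` by `u_b`. -/
def Seq.replace {M : ℤ} (k : Seq M) (j : ℕ) (b : ℤ) : Seq M :=
  ⟨Function.update k.1 j b, by
    filter_upwards [k.2, Filter.eventually_gt_atTop j] with i hi hj
    rw [Function.update_of_ne hj.ne', hi]⟩

/-- Interchange the factors in positions `i` and `i + 1`. -/
def Seq.swap {M : ℤ} (k : Seq M) (i : ℕ) : Seq M :=
  ⟨fun j => k.1 (Equiv.swap i (i + 1) j), by
    filter_upwards [k.2, Filter.eventually_gt_atTop (i + 1)] with j hj h
    rw [Equiv.swap_apply_of_ne_of_ne (by omega) (by omega), hj]⟩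

/-- The sum over `i` of the spaces of tensors that are symmetric in the factors `i`, `i + 1`. At
`q = 1` the Hecke operators are `T_i^c = -K_{i,i+1}` (`K_{i,i+1}` exchanges `z_i`, `z_{i+1}`) and
`T_i^s =` the flip of `v_{ε_i}`, `v_{ε_{i+1}}`, hence `Ker (T_i^c + q² (T_i^s)⁻¹)` consists of
the symmetric tensors. -/
noncomputable def wedgeRel (M : ℤ) : Submodule ℂ (Seq M →₀ ℂ) :=
  Submodule.span ℂ
    {x | ∃ (k : Seq M) (i : ℕ), x = Finsupp.single k 1 + Finsupp.single (k.swap i) 1}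

/-- The Fock space `F_M` at `q = 1`: semi-infinite wedges of charge `M`. -/
abbrev Fock (M : ℤ) : Type := (Seq M →₀ ℂ) ⧸ wedgeRel M

/-- The semi-infinite wedge `u_{k_0} ∧ u_{k_1} ∧ ⋯`. -/
noncomputable def wedge {M : ℤ} (k : Seq M) : Fock M :=
  (wedgeRel M).mkQ (Finsupp.single k 1)

/-- The vacuum vector `|M⟩ = u_M ∧ u_{M-1} ∧ ⋯`. -/
noncomputable def vac (M : ℤ) : Fock M :=
  wedge ⟨fun i => M - i, Filter.Eventually.of_forall fun _ => rfl⟩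

/-- The `j`-th term of `∑_j X_j` on the wedge of `k`: `X` is applied to the factor `j`. -/
noncomputable def applyAt {M : ℤ} (X : Module.End ℂ Vz) (k : Seq M) (j : ℕ) : Fock M :=
  (X (u (k.1 j))).sum fun b a => a • wedge (k.replace j b)

/-- `T = ∑_{j} X_j` on `F_M`, where on each wedge only finitely many terms are nonzero. -/
def ActsBy {M : ℤ} (T : Module.End ℂ (Fock M)) (X : Module.End ℂ Vz) : Prop :=
  ∀ k : Seq M, (Function.support (applyAt X k)).Finite ∧
    T (wedge k) = ∑ᶠ j : ℕ, applyAt X k j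

/-! ### The action -/

/-- The one-particle operator of the horizontal Chevalley generator `E_i`. -/
noncomputable def opE (n : ℕ) (i : ZMod n) : Module.End ℂ Vz :=
  if i = 0 then zPow n 1 * matUnit n n 1 else matUnit n i.val (i.val + 1)

/-- The one-particle operator of the horizontal Chevalley generator `F_i`. -/
noncomputable def opF (n : ℕ) (i : ZMod n) : Module.End ℂ Vz :=
  if i = 0 then zPow n (-1) * matUnit n 1 n else matUnit n (i.val + 1) i.val

/-- `ρ` is the toroidal action on the Fock space at `q = 1`, given on the Chevalley generators of
the horizontal and of the vertical subalgebra, which together generate. -/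
structure IsFockAction (n : ℕ) (p κ : ℂ) (M : ℤ)
    (ρ : Tor n κ →ₐ[ℂ] Module.End ℂ (Fock M)) : Prop where
  /-- `E_i = ∑_j E_j^{i,i+1}` for `1 ≤ i ≤ n - 1`, and `E_0 = ∑_j z_j E_j^{n,1}`. -/
  E : ∀ i : ZMod n, ActsBy (ρ (tor n κ (.E i 0))) (opE n i)
  /-- `F_i = ∑_j E_j^{i+1,i}` for `1 ≤ i ≤ n - 1`, and `F_0 = ∑_j z_j⁻¹ E_j^{1,n}`. -/
  F : ∀ i : ZMod n, ActsBy (ρ (tor n κ (.F i 0))) (opF n i)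
  /-- Normalization of the Cartan subalgebra; for `i = 0` it gives horizontal level `1`. -/
  H : ∀ i : ZMod n, ρ (tor n κ (.H i 0)) (vac M) = if (M : ZMod n) = i then vac M else 0
  /-- `𝐞₀ = ∑_j p^{-D_j} E_j^{n,1}`. -/
  e0 : ActsBy (ρ (vertE0 n κ)) (pD n p (-1) * matUnit n n 1)
  /-- `𝐟₀ = ∑_j p^{D_j} E_j^{1,n}`. -/
  f0 : ActsBy (ρ (vertF0 n κ)) (pD n p 1 * matUnit n 1 n)
  /-- The vertical level is `0`. -/
  c : ρ (tor n κ .c) = 0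

/-- The module defined by `ρ` is irreducible (simple). -/
def IsIrreducible {n : ℕ} {κ : ℂ} {M : ℤ}
    (ρ : Tor n κ →ₐ[ℂ] Module.End ℂ (Fock M)) : Prop :=
  letI : Module (Tor n κ) (Fock M) := Module.compHom (Fock M) ρ.toRingHom
  IsSimpleModule (Tor n κ) (Fock M)

end ToroidalFock

namespace ToroidalFock

/-! ### Index sequences of semi-infinite tensors -/

variable {M : ℤ}

/-! The matrix units `u_b ↦ u_a` of gl_∞ act on the Fock space as derivations (`unitOp`), with no
central term (`lie_unitOp`). Put `x_s = κ ^ (1 - s)`. For existence, `E_{i,k}`, `F_{i,k}`, `H_{i,k}`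
act as the sums over `s ≡ i` mod `n` of `x_s ^ k` times `raise M s`, `lower M s`, `coroot M s`.
These sums are locally finite, and the toroidal relations reduce to those of A_∞ because `n ≥ 3`
keeps members of one residue class at distance at least 3 and because `x_s = κ x_{s+1}`
(`genOp_rel`). Since `κ ^ n = p⁻¹`, the iterated brackets give the prescribed vertical generators.

For irreducibility, wedges span, so any action agrees with this one on `E_{i,0}`, `F_{i,0}` and
`𝐞₀`; these already suffice. Brackets with the `E_{i,0}` strip `𝐞₀` down to `F_{1,1}`, whence
`H_{1,1} = [E_{1,0}, F_{1,1}]`, and brackets with `H_{1,1}` produce `E_{1,l}`, `F_{1,l}` for all `l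
≥ 0`. As `|κ| ≠ 1`, the `x_s` are distinct, and Lagrange interpolation isolates each `raise M s`,
`lower M s` with `s ≡ 1`. Their coroot then isolates the neighbours at `s + 1`, and so on upwards
(`preserves_raise_lower`). So an invariant subspace is stable under the Chevalley generators of
gl_∞. Occupation numbers separate the basic wedges, and moving one box at a time connects each of
them with the vacuum (`eq_bot_or_eq_top_of_preserves`). -/

theorem Seq.ext_apply {k l : Seq M} (h : ∀ j, k.1 j = l.1 j) : k = l :=
  Subtype.ext (funext h)

theorem Seq.replace_apply (k : Seq M) (j : ℕ) (b : ℤ) (i : ℕ) :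
    (k.replace j b).1 i = if i = j then b else k.1 i := by
  simp [Seq.replace, Function.update_apply]

theorem Seq.swap_apply (k : Seq M) (i j : ℕ) :
    (k.swap i).1 j = k.1 (Equiv.swap i (i + 1) j) := rfl

theorem Seq.replace_replace_comm (k : Seq M) {i j : ℕ} (h : i ≠ j) (a b : ℤ) :
    (k.replace i a).replace j b = (k.replace j b).replace i a := by
  refine Seq.ext_apply fun l => ?_
  simp only [Seq.replace_apply]
  grind

theorem Seq.replace_replace_same (k : Seq M) (i : ℕ) (a b : ℤ) :
    (k.replace i a).replace i b = k.replace i b := by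
  refine Seq.ext_apply fun l => ?_
  simp only [Seq.replace_apply]
  grind

theorem Seq.swap_replace (k : Seq M) (i j : ℕ) (a : ℤ) :
    (k.swap i).replace j a = (k.replace (Equiv.swap i (i + 1) j) a).swap i := by
  refine Seq.ext_apply fun l => ?_
  simp only [Seq.replace_apply, Seq.swap_apply, EmbeddingLike.apply_eq_iff_eq]

theorem Seq.exists_eq (k : Seq M) : ∃ N : ℕ, ∀ i ≥ N, k.1 i = M - i :=
  Filter.eventually_atTop.1 k.2

theorem Seq.finite_fiber (k : Seq M) (b : ℤ) : {j | k.1 j = b}.Finite := by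
  obtain ⟨N, hN⟩ := k.exists_eq
  refine (Set.finite_lt_nat (N + (M - b).toNat + 1)).subset fun j hj => ?_
  by_contra hlt
  simp only [Set.mem_ofPred_eq, not_lt] at hj hlt
  have := hN j (by omega)
  omega

/-! ### Wedges -/

theorem wedge_swap (k : Seq M) (i : ℕ) : wedge (k.swap i) = -wedge k := by
  rw [eq_neg_iff_add_eq_zero, add_comm, wedge, wedge, ← map_add]
  exact (Submodule.Quotient.mk_eq_zero _).2 (Submodule.subset_span ⟨k, i, rfl⟩)

theorem span_range_wedge : Submodule.span ℂ (Set.range (wedge (M := M))) = ⊤ := by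
  have h : Submodule.map (wedgeRel M).mkQ
      (Submodule.span ℂ (Set.range fun k : Seq M => Finsupp.single k (1 : ℂ))) = ⊤ := by
    have : Submodule.span ℂ (Set.range fun k : Seq M => Finsupp.single k (1 : ℂ)) = ⊤ := by
      simpa using (Finsupp.basisSingleOne (R := ℂ) (ι := Seq M)).span_eq
    rw [this, Submodule.map_top, Submodule.range_mkQ]
  rw [Submodule.map_span, ← Set.range_comp] at h
  exact h

theorem end_ext {T T' : Module.End ℂ (Fock M)} (h : ∀ k, T (wedge k) = T' (wedge k)) :
    T = T' :=
  LinearMap.ext_on span_range_wedge (by rintro _ ⟨k, rfl⟩; exact h k)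

theorem wedge_eq_zero_of_eq_succ {k : Seq M} {i : ℕ} (h : k.1 i = k.1 (i + 1)) :
    wedge k = 0 := by
  have hk : k.swap i = k := by
    refine Seq.ext_apply fun j => ?_
    rw [Seq.swap_apply, Equiv.swap_apply_def]
    grind
  have := wedge_swap k i
  rw [hk] at this
  have h2 : (2 : ℂ) • wedge k = 0 := by
    rw [two_smul]
    nth_rewrite 1 [this]
    exact neg_add_cancel _
  exact (smul_eq_zero.1 h2).resolve_left two_ne_zero

/-- Adjacent transpositions generate the symmetric group, and each of them costs one sign. -/
theorem exists_permuted (N : ℕ) (σ : Equiv.Perm (Fin (N + 1))) :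
    ∀ k : Seq M, ∃ d : Seq M, (∀ i : Fin (N + 1), d.1 i = k.1 (σ i)) ∧
      (∀ i, N + 1 ≤ i → d.1 i = k.1 i) ∧ (wedge k = wedge d ∨ wedge k = -wedge d) := by
  have hσ : σ ∈ Submonoid.closure
      (Set.range fun i : Fin N => Equiv.swap i.castSucc i.succ) := by
    rw [Equiv.Perm.mclosure_swap_castSucc_succ]; trivial
  induction hσ using Submonoid.closure_induction with
  | mem σ h =>
    obtain ⟨a, rfl⟩ := h
    refine fun k => ⟨k.swap a, fun i => ?_, fun i hi => ?_, Or.inr ?_⟩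
    · rw [Seq.swap_apply, Equiv.swap_apply_def, Equiv.swap_apply_def]
      simp only [Fin.ext_iff, Fin.val_castSucc, Fin.val_succ]
      split_ifs <;> simp
    · rw [Seq.swap_apply, Equiv.swap_apply_of_ne_of_ne] <;> omega
    · rw [wedge_swap, neg_neg]
  | one => exact fun k => ⟨k, fun i => rfl, fun i _ => rfl, Or.inl rfl⟩
  | mul σ τ _ _ hσ hτ =>
    intro k
    obtain ⟨d, h1, h2, h3⟩ := hσ k
    obtain ⟨d', h1', h2', h3'⟩ := hτ d
    refine ⟨d', fun i => by rw [h1', h1]; rfl, fun i hi => by rw [h2' i hi, h2 i hi], ?_⟩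
    rcases h3 with h3 | h3 <;> rcases h3' with h3' | h3' <;> simp [h3, h3']

/-- Beyond some position the factors are those of the vacuum, and smaller than all earlier ones. -/
theorem Seq.exists_tail (k : Seq M) :
    ∃ N : ℕ, (∀ i ≥ N, k.1 i = M - i) ∧ ∀ i < N, M - N < k.1 i := by
  obtain ⟨N, hN⟩ := k.exists_eq
  obtain ⟨B, hB⟩ := (Set.finite_lt_nat N).image (fun i => M - k.1 i) |>.bddAbove
  -- `B` bounds `M - k_i` on the irregular prefix; past this cutoff the tail lies below all earlier
  -- entries.
  refine ⟨N + B.toNat + 1, fun i hi => hN i (by omega), fun i hi => ?_⟩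
  by_cases h : i < N
  · have : M - k.1 i ≤ B := hB ⟨i, h, rfl⟩
    push_cast
    omega
  · have := hN i (by omega)
    omega

/-- Only a finite prefix needs sorting, as the tail is already decreasing and lies below it. The
last clause carries a repetition in `k` over to `d`, where equal entries are adjacent. -/
theorem exists_antitone (k : Seq M) : ∃ d : Seq M, Antitone d.1 ∧
    (wedge k = wedge d ∨ wedge k = -wedge d) ∧
    (Function.Injective d.1 → Function.Injective k.1) := by
  obtain ⟨N, h1, h2⟩ : ∃ N : ℕ, (∀ i ≥ N + 1, k.1 i = M - i) ∧
      ∀ i < N + 1, M - ((N + 1 : ℕ) : ℤ) < k.1 i := by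
    obtain ⟨N, h1, h2⟩ := k.exists_tail
    refine ⟨N, fun i hi => h1 i (by omega), fun i hi => ?_⟩
    rcases Nat.lt_succ_iff_lt_or_eq.1 hi with h | h
    · have := h2 i h; push_cast; omega
    · have := h1 i h.ge; push_cast; omega
  -- Negation turns the increasing sort into a decreasing one.
  set σ := Tuple.sort fun i : Fin (N + 1) => -k.1 i with hσ
  have hmono : Monotone ((fun i : Fin (N + 1) => -k.1 i) ∘ σ) := Tuple.monotone_sort _
  obtain ⟨d, hd1, hd2, hd3⟩ := exists_permuted N σ k
  refine ⟨d, antitone_nat_of_succ_le fun i => ?_, hd3, fun hd a b hab => ?_⟩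
  · rcases lt_trichotomy i N with h | h | h
    · have h3 : -k.1 (σ ⟨i, by omega⟩) ≤ -k.1 (σ ⟨i + 1, by omega⟩) :=
        hmono (a := ⟨i, by omega⟩) (b := ⟨i + 1, by omega⟩) (by simp)
      have h4 := hd1 ⟨i, by omega⟩
      have h5 := hd1 ⟨i + 1, by omega⟩
      simp only at h4 h5
      omega
    · have h4 := hd1 ⟨i, by omega⟩
      have h5 := h2 (σ ⟨i, by omega⟩) (σ _).2
      have h6 := hd2 (i + 1) (by omega)
      have h7 := h1 (i + 1) (by omega)
      simp only at h4
      subst h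
      omega
    · rw [hd2 _ h, hd2 _ (by omega), h1 _ h, h1 _ (by omega)]
      push_cast; omega
  · by_cases ha : a < N + 1 <;> by_cases hb : b < N + 1
    · have e1 := hd1 (σ.symm ⟨a, ha⟩)
      have e2 := hd1 (σ.symm ⟨b, hb⟩)
      rw [Equiv.apply_symm_apply] at e1 e2
      have := σ.symm.injective (Fin.ext (hd (e1.trans (hab.trans e2.symm))))
      simpa using this
    · have := h2 a ha
      have := h1 b (by omega)
      omega
    · have := h2 b hb
      have := h1 a (by omega)
      omega
    · have := h1 b (by omega)
      have := h1 a (by omega)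
      omega

theorem exists_strictAnti_or (k : Seq M) :
    (∃ d : Seq M, StrictAnti d.1 ∧ (wedge k = wedge d ∨ wedge k = -wedge d)) ∨
      wedge k = 0 := by
  obtain ⟨d, hd, h, -⟩ := exists_antitone k
  by_cases hs : ∃ i, d.1 i = d.1 (i + 1)
  · obtain ⟨i, hi⟩ := hs
    right
    rcases h with h | h <;> simp [h, wedge_eq_zero_of_eq_succ hi]
  · push Not at hs
    exact Or.inl ⟨d, strictAnti_nat_of_succ_lt fun i => (hd i.le_succ).lt_of_ne' (hs i), h⟩

theorem wedge_eq_zero_of_eq {k : Seq M} {i j : ℕ} (hij : i ≠ j) (h : k.1 i = k.1 j) :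
    wedge k = 0 := by
  obtain ⟨d, hd, hw, hinj⟩ := exists_antitone k
  by_cases hs : ∃ i, d.1 i = d.1 (i + 1)
  · obtain ⟨i, hi⟩ := hs
    rcases hw with h | h <;> simp [h, wedge_eq_zero_of_eq_succ hi]
  · push Not at hs
    have : StrictAnti d.1 :=
      strictAnti_nat_of_succ_lt fun i => (hd i.le_succ).lt_of_ne' (hs i)
    exact absurd (hinj this.injective h) hij

/-! ### The vacuum does not vanish -/

/-- The sign of the permutation that sorts the first `N` entries, `0` if two of them agree. -/
def sortSign (k : ℕ → ℤ) (N : ℕ) : ℤ :=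
  ∏ j ∈ Finset.range N, ∏ i ∈ Finset.range j, (k i - k j).sign

/-- Only the factor of the pair `(i, i + 1)` changes sign; the others are permuted. The length `i +
2 + N` guarantees that both positions lie in the prefix. -/
theorem sortSign_swap (k : ℕ → ℤ) (i N : ℕ) :
    sortSign (fun j => k (Equiv.swap i (i + 1) j)) (i + 2 + N) = -sortSign k (i + 2 + N) := by
  have hlt : ∀ j, j < i → Equiv.swap i (i + 1) j = j := fun j hj =>
    Equiv.swap_apply_of_ne_of_ne (by omega) (by omega)
  have hgt : ∀ j, i + 1 < j → Equiv.swap i (i + 1) j = j := fun j hj =>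
    Equiv.swap_apply_of_ne_of_ne (by omega) (by omega)
  induction N with
  | zero =>
    simp only [sortSign, add_zero, Finset.prod_range_succ, Equiv.swap_apply_left,
      Equiv.swap_apply_right]
    have h1 : ∏ j ∈ Finset.range i, ∏ l ∈ Finset.range j,
        (k (Equiv.swap i (i + 1) l) - k (Equiv.swap i (i + 1) j)).sign =
        ∏ j ∈ Finset.range i, ∏ l ∈ Finset.range j, (k l - k j).sign := by
      refine Finset.prod_congr rfl fun j hj => Finset.prod_congr rfl fun l hl => ?_
      rw [Finset.mem_range] at hj hl
      rw [hlt l (by omega), hlt j hj]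
    have h2 : ∀ c, ∏ l ∈ Finset.range i, (k (Equiv.swap i (i + 1) l) - c).sign =
        ∏ l ∈ Finset.range i, (k l - c).sign := fun c =>
      Finset.prod_congr rfl fun l hl => by rw [hlt l (Finset.mem_range.1 hl)]
    rw [h1, h2, h2, ← neg_sub (k i) (k (i + 1)), Int.sign_neg]
    ring
  | succ N ih =>
    unfold sortSign at ih ⊢
    rw [← add_assoc, Finset.prod_range_succ, ih, Finset.prod_range_succ _ (i + 2 + N), neg_mul]
    congr 2
    simp only [hgt (i + 2 + N) (by omega)]
    refine Finset.prod_equiv (Equiv.swap i (i + 1)) (fun j => ?_) fun j _ => rfl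
    rw [Finset.mem_range, Finset.mem_range, Equiv.swap_apply_def]
    split_ifs <;> omega

theorem Seq.exists_sortSign_eq (k : Seq M) :
    ∃ N : ℕ, ∀ m ≥ N, sortSign k.1 m = sortSign k.1 N := by
  obtain ⟨N, h1, h2⟩ := k.exists_tail
  refine ⟨N, fun m hm => ?_⟩
  induction m, hm using Nat.le_induction with
  | base => rfl
  | succ m hm ih =>
    rw [sortSign, Finset.prod_range_succ, ← sortSign, ih, Finset.prod_eq_one, mul_one]
    intro i hi
    rw [Int.sign_eq_one_iff_pos, h1 m hm]
    rw [Finset.mem_range] at hi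
    by_cases h : i < N
    · have := h2 i h; omega
    · have := h1 i (by omega); omega

/-- The eventual value of `sortSign`. -/
noncomputable def Seq.sign (k : Seq M) : ℤ := sortSign k.1 k.exists_sortSign_eq.choose

theorem Seq.eventually_sortSign (k : Seq M) :
    ∀ᶠ m in Filter.atTop, sortSign k.1 m = k.sign :=
  Filter.eventually_atTop.2 ⟨_, k.exists_sortSign_eq.choose_spec⟩

theorem Seq.sign_swap (k : Seq M) (i : ℕ) : (k.swap i).sign = -k.sign := by
  obtain ⟨m, ⟨h1, h2⟩, h3⟩ := (((k.swap i).eventually_sortSign.and k.eventually_sortSign).and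
    (Filter.eventually_ge_atTop (i + 2))).exists
  rw [← h1, ← h2]
  obtain ⟨N, rfl⟩ := Nat.exists_eq_add_of_le h3
  exact sortSign_swap k.1 i N

/-- The functional given by the sorting sign kills the wedge relations and equals 1 on the vacuum.
-/
theorem vac_ne_zero (M : ℤ) : vac M ≠ 0 := by
  intro h
  have hle : wedgeRel M ≤
      LinearMap.ker (Finsupp.linearCombination ℂ fun k : Seq M => (k.sign : ℂ)) := by
    refine Submodule.span_le.2 ?_
    rintro _ ⟨k, i, rfl⟩
    simp [Seq.sign_swap]
  have h0 := hle ((Submodule.Quotient.mk_eq_zero _).1 h)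
  set k : Seq M := ⟨fun i => M - i, Filter.Eventually.of_forall fun _ => rfl⟩ with hk
  have h1 : k.sign = 1 := by
    obtain ⟨m, hm⟩ := k.eventually_sortSign.exists
    rw [← hm, sortSign]
    refine Finset.prod_eq_one fun j _ => Finset.prod_eq_one fun i hi => ?_
    rw [Int.sign_eq_one_iff_pos]
    rw [Finset.mem_range] at hi
    simp only [hk]
    omega
  simp [h1] at h0

/-! ### Matrix units on the Fock space -/

/-- The summand in position `j` of the image of the wedge of `k` under a matrix unit. -/
noncomputable def unitTerm (a b : ℤ) (k : Seq M) (j : ℕ) : Fock M :=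
  if k.1 j = b then wedge (k.replace j a) else 0

theorem finsum_unitTerm_swap (a b : ℤ) (k : Seq M) (i : ℕ) :
    ∑ᶠ j, unitTerm a b (k.swap i) j = -∑ᶠ j, unitTerm a b k j := by
  rw [← finsum_comp_equiv (Equiv.swap i (i + 1)), ← finsum_neg_distrib]
  refine finsum_congr fun j => ?_
  rw [unitTerm, unitTerm, Seq.swap_apply, Seq.swap_replace, wedge_swap]
  simp only [Equiv.swap_apply_self]
  split_ifs
  · rfl
  · rw [neg_zero]

/-- The matrix unit `u_b ↦ u_a` acting on the Fock space as a derivation. -/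
noncomputable def unitOp (a b : ℤ) : Module.End ℂ (Fock M) :=
  (wedgeRel M).liftQ (Finsupp.linearCombination ℂ fun k => ∑ᶠ j, unitTerm a b k j) <| by
    refine Submodule.span_le.2 ?_
    rintro _ ⟨k, i, rfl⟩
    simp [finsum_unitTerm_swap]

theorem unitOp_wedge (a b : ℤ) (k : Seq M) :
    unitOp a b (wedge k) = ∑ᶠ j, unitTerm a b k j := by
  refine (Submodule.liftQ_apply _ _ _).trans ?_
  simp

theorem unitOp_wedge_eq_sum (a b : ℤ) (k : Seq M) {s : Finset ℕ}
    (hs : ∀ j, k.1 j = b → j ∈ s) : unitOp a b (wedge k) = ∑ j ∈ s, unitTerm a b k j := by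
  rw [unitOp_wedge]
  refine finsum_eq_sum_of_support_subset _ fun j hj => hs j ?_
  by_contra h
  exact hj (if_neg h)

/-- The product splits into a two-body part, where distinct factors are hit, and a one-body part,
where the same factor is hit twice. The two-body part is symmetric in the two operators and cancels
in the commutator. -/
theorem unitOp_mul_wedge (a b c d : ℤ) (k : Seq M) {s : Finset ℕ}
    (hb : ∀ j, k.1 j = b → j ∈ s) (hd : ∀ j, k.1 j = d → j ∈ s) :
    (unitOp a b * unitOp c d : Module.End ℂ (Fock M)) (wedge k) =
      (∑ j ∈ s, ∑ i ∈ s, if i ≠ j ∧ k.1 j = d ∧ k.1 i = b then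
        wedge ((k.replace j c).replace i a) else 0) +
      if b = c then unitOp a d (wedge k) else 0 := by
  have h1 : (if b = c then unitOp a d (wedge k) else 0) =
      ∑ j ∈ s, if b = c then unitTerm a d k j else 0 := by
    rw [unitOp_wedge_eq_sum a d k hd]
    split_ifs <;> simp
  rw [Module.End.mul_apply, unitOp_wedge_eq_sum c d k hd, map_sum, h1, ← Finset.sum_add_distrib]
  refine Finset.sum_congr rfl fun j hj => ?_
  by_cases hjd : k.1 j = d
  swap
  · simp [unitTerm, hjd]
  rw [unitTerm, if_pos hjd, unitOp_wedge_eq_sum a b _ (s := s)]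
  swap
  · intro i hi
    rw [Seq.replace_apply] at hi
    split_ifs at hi with h
    · exact h ▸ hj
    · exact hb i hi
  have h2 : (if b = c then unitTerm a d k j else 0) =
      ∑ i ∈ s, if i = j then (if b = c then unitTerm a d k j else 0) else 0 := by
    rw [Finset.sum_ite_eq' s j, if_pos hj]
  rw [h2, ← Finset.sum_add_distrib]
  refine Finset.sum_congr rfl fun i _ => ?_
  by_cases hij : i = j
  · subst hij
    simp [unitTerm, Seq.replace_apply, hjd, Seq.replace_replace_same, eq_comm]
  · simp [unitTerm, Seq.replace_apply, hjd, hij]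

/-- No cocycle appears: each index occurs finitely often in a sequence, so `unitOp b b` is the
honest occupation number and needs no normal ordering. -/
theorem lie_unitOp (a b c d : ℤ) :
    ⁅(unitOp a b : Module.End ℂ (Fock M)), (unitOp c d : Module.End ℂ (Fock M))⁆ =
      (if b = c then unitOp a d else 0) - if a = d then unitOp c b else 0 := by
  refine end_ext fun k => ?_
  set s := (k.finite_fiber b).toFinset ∪ (k.finite_fiber d).toFinset
  have hb : ∀ j, k.1 j = b → j ∈ s := fun j hj => by simp [s, hj]
  have hd : ∀ j, k.1 j = d → j ∈ s := fun j hj => by simp [s, hj]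
  rw [Ring.lie_def, LinearMap.sub_apply, unitOp_mul_wedge a b c d k hb hd,
    unitOp_mul_wedge c d a b k hd hb]
  have : (∑ j ∈ s, ∑ i ∈ s, if i ≠ j ∧ k.1 j = d ∧ k.1 i = b then
        wedge ((k.replace j c).replace i a) else 0) =
      ∑ j ∈ s, ∑ i ∈ s, if i ≠ j ∧ k.1 j = b ∧ k.1 i = d then
        wedge ((k.replace j a).replace i c) else 0 := by
    rw [Finset.sum_comm]
    refine Finset.sum_congr rfl fun j _ => Finset.sum_congr rfl fun i _ => ?_
    by_cases h : i = j
    · simp [h]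
    · rw [Seq.replace_replace_comm k h]
      simp [h, Ne.symm h, and_comm]
  rw [this]
  simp only [LinearMap.sub_apply, eq_comm (a := d)]
  split_ifs <;> simp

/-! ### Locally finite sums of operators -/

section LocallyFinite

variable {V : Type*} [AddCommGroup V] [Module ℂ V]

/-- A family of operators such that on each vector almost all of them vanish. -/
def LocFin (A : ℤ → Module.End ℂ V) : Prop := ∀ v, (Function.support fun s => A s v).Finite

open Classical in
/-- The sum of a locally finite family of operators (and `0` if it is not locally finite). -/
noncomputable def lsum (A : ℤ → Module.End ℂ V) : Module.End ℂ V :=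
  if hA : LocFin A then
    { toFun := fun v => ∑ᶠ s, A s v
      map_add' := fun v w => by
        simp only [map_add]
        exact finsum_add_distrib (hA v) (hA w)
      map_smul' := fun c v => by
        simp only [map_smul, RingHom.id_apply]
        exact (smul_finsum c _).symm }
  else 0

theorem lsum_apply {A : ℤ → Module.End ℂ V} (hA : LocFin A) (v : V) :
    lsum A v = ∑ᶠ s, A s v := by
  rw [lsum, dif_pos hA]; rfl

theorem LocFin.smul {A : ℤ → Module.End ℂ V} (hA : LocFin A) (c : ℤ → ℂ) :
    LocFin fun s => c s • A s := fun v =>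
  (hA v).subset fun s hs h => hs (by
    change A s v = 0 at h
    simp [h])

theorem LocFin.lie_right {A : ℤ → Module.End ℂ V} (hA : LocFin A) (B : Module.End ℂ V) :
    LocFin fun s => ⁅A s, B⁆ := fun v =>
  ((hA (B v)).union (hA v)).subset fun s hs => by
    by_contra h
    simp only [Set.mem_union, Function.mem_support, not_or, not_not] at h
    exact hs (by simp [Ring.lie_def, h.1, h.2])

theorem lie_eq_neg_lie (A B : Module.End ℂ V) : ⁅A, B⁆ = -⁅B, A⁆ := by
  rw [Ring.lie_def, Ring.lie_def, neg_sub]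

theorem LocFin.lie_left {A : ℤ → Module.End ℂ V} (hA : LocFin A) (B : Module.End ℂ V) :
    LocFin fun s => ⁅B, A s⁆ := fun v => by
  simpa [lie_eq_neg_lie B, Function.support] using hA.lie_right B v

theorem LocFin.lie_pointwise {A B : ℤ → Module.End ℂ V} (hA : LocFin A) (hB : LocFin B) :
    LocFin fun s => ⁅A s, B s⁆ := fun v => by
  have h : ∀ (A B : ℤ → Module.End ℂ V), LocFin B →
      (Function.support fun s => A s (B s v)).Finite := fun A B hB =>
    (hB v).subset fun s hs h => hs (by
      change B s v = 0 at h
      simp [h])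
  refine ((h A B hB).union (h B A hA)).subset fun s hs => ?_
  by_contra h
  simp only [Set.mem_union, Function.mem_support, not_or, not_not] at h
  exact hs (by simp [Ring.lie_def, h.1, h.2])

theorem lie_lsum_left {A : ℤ → Module.End ℂ V} (hA : LocFin A) (B : Module.End ℂ V) :
    ⁅lsum A, B⁆ = lsum fun s => ⁅A s, B⁆ := by
  refine LinearMap.ext fun v => ?_
  rw [lsum_apply (hA.lie_right B), Ring.lie_def, LinearMap.sub_apply, Module.End.mul_apply,
    Module.End.mul_apply, lsum_apply hA, lsum_apply hA,
    map_finsum B (hA v), ← finsum_sub_distrib (hA (B v))]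
  · rfl
  · exact (hA v).subset fun s hs h => hs (by
      change A s v = 0 at h
      simp [h])

theorem lsum_smul {A : ℤ → Module.End ℂ V} (hA : LocFin A) (c : ℂ) :
    (lsum fun s => c • A s) = c • lsum A := by
  refine LinearMap.ext fun v => ?_
  rw [lsum_apply (hA.smul fun _ => c), LinearMap.smul_apply, lsum_apply hA, smul_finsum]
  rfl

theorem lie_lsum_right {A : ℤ → Module.End ℂ V} (hA : LocFin A) (B : Module.End ℂ V) :
    ⁅B, lsum A⁆ = lsum fun s => ⁅B, A s⁆ := by
  rw [lie_eq_neg_lie, lie_lsum_left hA, ← neg_one_smul ℂ, ← lsum_smul (hA.lie_right B)]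
  congr 1
  funext s
  rw [neg_one_smul, ← lie_eq_neg_lie]

theorem lsum_zero : lsum (fun _ => 0 : ℤ → Module.End ℂ V) = 0 := by
  refine LinearMap.ext fun v => ?_
  rw [lsum_apply fun v => by simp [Function.support]]
  simp

theorem lsum_eq_single {A : ℤ → Module.End ℂ V} (t : ℤ) (h : ∀ s, s ≠ t → A s = 0) :
    lsum A = A t := by
  refine LinearMap.ext fun v => ?_
  rw [lsum_apply]
  · exact finsum_eq_single _ _ fun s hs => by rw [h s hs, LinearMap.zero_apply]
  · refine fun v => (Set.finite_singleton t).subset fun s hs => ?_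
    by_contra hst
    exact hs (by simp [h s hst])

theorem smul_lie_lsum_congr {A B A' B' : ℤ → Module.End ℂ V} (hA : LocFin A) (hB : LocFin B)
    (hA' : LocFin A') (hB' : LocFin B') (c : ℂ)
    (h : ∀ s t, c • ⁅A s, B t⁆ = ⁅A' s, B' t⁆) : c • ⁅lsum A, lsum B⁆ = ⁅lsum A', lsum B'⁆ := by
  rw [lie_lsum_left hA, lie_lsum_left hA', ← lsum_smul (hA.lie_right _)]
  congr 1
  funext s
  rw [lie_lsum_right hB, lie_lsum_right hB', ← lsum_smul]
  · simp only [h]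
  · exact hB.lie_left (A s)

/-- The double sum collapses because each `s` on the right meets only `s + r` on the left; the
primed version has the roles exchanged. -/
theorem lie_lsum_eq {A B C : ℤ → Module.End ℂ V} (hA : LocFin A) (hB : LocFin B) (r : ℤ)
    (h : ∀ s, ⁅A (s + r), B s⁆ = C s) (h0 : ∀ s t, t ≠ s + r → ⁅A t, B s⁆ = 0) :
    ⁅lsum A, lsum B⁆ = lsum C := by
  rw [lie_lsum_right hB]
  congr 1
  funext s
  rw [lie_lsum_left hA, lsum_eq_single (s + r) (h0 s), h]

theorem lie_lsum_eq' {A B C : ℤ → Module.End ℂ V} (hA : LocFin A) (hB : LocFin B) (r : ℤ)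
    (h : ∀ s, ⁅A s, B (s + r)⁆ = C s) (h0 : ∀ s t, t ≠ s + r → ⁅A s, B t⁆ = 0) :
    ⁅lsum A, lsum B⁆ = lsum C := by
  rw [lie_lsum_left hA]
  congr 1
  funext s
  rw [lie_lsum_right hB, lsum_eq_single (s + r) (h0 s), h]

theorem lie_lsum_eq_zero {A B : ℤ → Module.End ℂ V} (hA : LocFin A) (hB : LocFin B)
    (h : ∀ s t, ⁅A s, B t⁆ = 0) : ⁅lsum A, lsum B⁆ = 0 := by
  rw [lie_lsum_eq hA hB 0 (C := fun _ => 0) (fun s => h _ _) fun s t _ => h _ _, lsum_zero]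

theorem lie_lie_lsum_eq_zero {A A' B : ℤ → Module.End ℂ V} (hA : LocFin A) (hA' : LocFin A')
    (hB : LocFin B) (h : ∀ s s' t, ⁅A s, ⁅A' s', B t⁆⁆ = 0) :
    ⁅lsum A, ⁅lsum A', lsum B⁆⁆ = 0 := by
  rw [lie_lsum_left hA]
  convert lsum_zero with s
  rw [lie_lsum_left hA', lie_lsum_right (hA'.lie_right _)]
  convert lsum_zero with s'
  rw [lie_lsum_right hB, lie_lsum_right (hB.lie_left _)]
  convert lsum_zero with t
  exact h s s' t

end LocallyFinite

/-! ### Shift operators -/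

theorem locFin_of_wedge {A : ℤ → Module.End ℂ (Fock M)}
    (h : ∀ k, (Function.support fun s => A s (wedge k)).Finite) : LocFin A := by
  intro v
  have hv : v ∈ Submodule.span ℂ (Set.range (wedge (M := M))) := by
    rw [span_range_wedge]; trivial
  induction hv using Submodule.span_induction with
  | mem v hv =>
    obtain ⟨k, rfl⟩ := hv
    exact h k
  | zero => simp
  | add v w _ _ hv hw =>
    refine (hv.union hw).subset fun s hs => ?_
    by_contra hs'
    simp only [Set.mem_union, Function.mem_support, not_or, not_not] at hs'
    exact hs (by simp [hs'.1, hs'.2])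
  | smul c v _ hv =>
    refine hv.subset fun s hs hs' => hs ?_
    change A s v = 0 at hs'
    simp [hs']

/-- Far out, the shifted factor coincides with the one at position `j - r`, so the wedge vanishes.
This makes the sums of off-diagonal matrix units locally finite. -/
theorem Seq.finite_replace_add (k : Seq M) {r : ℤ} (hr : r ≠ 0) :
    (Function.support fun j => wedge (k.replace j (k.1 j + r))).Finite := by
  obtain ⟨N, hN⟩ := k.exists_eq
  refine (Set.finite_lt_nat (N + r.natAbs)).subset fun j hj => ?_
  by_contra hlt
  simp only [Set.mem_ofPred_eq, not_lt] at hlt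
  obtain ⟨i, hi⟩ : ∃ i : ℕ, (i : ℤ) = j - r := ⟨(j - r).toNat, by omega⟩
  refine hj (wedge_eq_zero_of_eq (i := i) (j := j) (by omega) ?_)
  rw [Seq.replace_apply, Seq.replace_apply, if_neg (by omega), if_pos rfl, hN i (by omega),
    hN j (by omega)]
  omega

/-- The point is that `J` does not depend on `s`, which later permits interchanging the sums over
`s` and over positions. -/
theorem unitOp_shift_wedge (a b : ℤ) (k : Seq M) {J : Finset ℕ}
    (hJ : ∀ j, wedge (k.replace j (k.1 j + (a - b))) ≠ 0 → j ∈ J) (s : ℤ) :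
    unitOp (s + a) (s + b) (wedge k) = ∑ j ∈ J, unitTerm (s + a) (s + b) k j := by
  rw [unitOp_wedge]
  refine finsum_eq_sum_of_support_subset _ fun j hj => hJ j fun h => hj ?_
  rw [unitTerm]
  split_ifs with hk
  · rwa [hk, show s + b + (a - b) = s + a by ring] at h
  · rfl

theorem locFin_unitOp {a b : ℤ} (hab : a ≠ b) :
    LocFin fun s => (unitOp (s + a) (s + b) : Module.End ℂ (Fock M)) := by
  refine locFin_of_wedge fun k => ?_
  have hf := k.finite_replace_add (sub_ne_zero.2 hab)
  refine (hf.toFinset.image fun j => k.1 j - b).finite_toSet.subset fun s hs => ?_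
  rw [Function.mem_support, unitOp_shift_wedge a b k (J := hf.toFinset) (by simp)] at hs
  obtain ⟨j, hj, hj0⟩ := Finset.exists_ne_zero_of_sum_ne_zero hs
  rw [unitTerm] at hj0
  have : k.1 j = s + b := by
    by_contra h
    exact hj0 (if_neg h)
  exact Finset.mem_coe.2 (Finset.mem_image.2 ⟨j, hj, by omega⟩)

theorem applyAt_shift {X : Module.End ℂ Vz} {k : Seq M} {j : ℕ} {c : ℂ} {b : ℤ}
    (h : X (u (k.1 j)) = c • u b) : applyAt X k j = c • wedge (k.replace j b) := by
  rw [applyAt, h, u, Finsupp.smul_single, smul_eq_mul, mul_one, Finsupp.sum_single_index]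
  exact zero_smul _ _

theorem actsBy_lsum {a b : ℤ} (hab : a ≠ b) (c : ℤ → ℂ) {X : Module.End ℂ Vz}
    (hX : ∀ t, X (u t) = c (t - b) • u (t - b + a)) :
    ActsBy (M := M) (lsum fun s => c s • unitOp (s + a) (s + b)) X := by
  intro k
  have hf := k.finite_replace_add (sub_ne_zero.2 hab)
  have happ : ∀ j, applyAt X k j = c (k.1 j - b) • wedge (k.replace j (k.1 j + (a - b))) := by
    intro j
    rw [applyAt_shift (hX (k.1 j)), sub_add_eq_add_sub, add_sub_assoc]
  have hsub : Function.support (applyAt X k) ⊆ hf.toFinset := by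
    intro j hj
    simp only [Set.Finite.coe_toFinset, Function.mem_support]
    intro h0
    exact hj (by rw [happ, h0, smul_zero])
  refine ⟨hf.toFinset.finite_toSet.subset hsub, ?_⟩
  rw [lsum_apply ((locFin_unitOp hab).smul c), finsum_eq_sum_of_support_subset _ hsub]
  have hsingle : ∀ j s, s ≠ k.1 j - b → c s • unitTerm (s + a) (s + b) k j = 0 := by
    intro j s hs
    rw [unitTerm, if_neg (by omega), smul_zero]
  simp only [LinearMap.smul_apply, unitOp_shift_wedge a b k (J := hf.toFinset) (by simp),
    Finset.smul_sum]
  rw [finsum_sum_comm]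
  · refine Finset.sum_congr rfl fun j _ => ?_
    rw [finsum_eq_single _ _ (hsingle j), happ, unitTerm, if_pos (by ring),
      sub_add_eq_add_sub, add_sub_assoc]
  · refine fun j _ => (Set.finite_singleton (k.1 j - b)).subset fun s hs => ?_
    by_contra h
    exact hs (hsingle j s h)

/-- Wedges span, so the prescribed formulas determine the operators. This is how an arbitrary action
is compared with the constructed one. -/
theorem ActsBy.unique {T T' : Module.End ℂ (Fock M)} {X : Module.End ℂ Vz} (h : ActsBy T X)
    (h' : ActsBy T' X) : T = T' :=
  end_ext fun k => by rw [(h k).2, (h' k).2]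

/-! ### Chevalley generators of `gl_∞` -/

/-- The raising operator `u_{s+1} ↦ u_s`. -/
noncomputable def raise (M s : ℤ) : Module.End ℂ (Fock M) := unitOp s (s + 1)

/-- The lowering operator `u_s ↦ u_{s+1}`. -/
noncomputable def lower (M s : ℤ) : Module.End ℂ (Fock M) := unitOp (s + 1) s

/-- The coroot: the difference of the occupation numbers at `s` and `s + 1`. -/
noncomputable def coroot (M s : ℤ) : Module.End ℂ (Fock M) := unitOp s s - unitOp (s + 1) (s + 1)

/-- The Cartan matrix of type `A_∞`. -/
def cartanInf (s t : ℤ) : ℤ :=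
  if s = t then 2 else if s = t + 1 ∨ t = s + 1 then -1 else 0

theorem locFin_raise : LocFin (raise M) := by
  have h := locFin_unitOp (M := M) (a := 0) (b := 1) (by norm_num)
  simp only [add_zero] at h
  exact h

theorem locFin_lower : LocFin (lower M) := by
  have h := locFin_unitOp (M := M) (a := 1) (b := 0) (by norm_num)
  simp only [add_zero] at h
  exact h

theorem lie_raise_lower_self (s : ℤ) : ⁅raise M s, lower M s⁆ = coroot M s := by
  simp [raise, lower, coroot, lie_unitOp]

theorem lie_raise_lower_of_ne {s t : ℤ} (h : s ≠ t) : ⁅raise M s, lower M t⁆ = 0 := by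
  simp [raise, lower, lie_unitOp, h]

/-- The operators `unitOp s s` alone are not locally finite, since infinitely many levels are
filled; their successive differences are, being brackets of locally finite families. -/
theorem locFin_coroot : LocFin (coroot M) := by
  simpa only [lie_raise_lower_self] using
    (locFin_raise (M := M)).lie_pointwise (locFin_lower (M := M))

/-! ### Commutation relations of type A_∞ -/

theorem sub_lie_end {V : Type*} [AddCommGroup V] [Module ℂ V] (A B C : Module.End ℂ V) :
    ⁅A - B, C⁆ = ⁅A, C⁆ - ⁅B, C⁆ := by
  simp only [Ring.lie_def, sub_mul, mul_sub]; abel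

theorem lie_sub_end {V : Type*} [AddCommGroup V] [Module ℂ V] (A B C : Module.End ℂ V) :
    ⁅A, B - C⁆ = ⁅A, B⁆ - ⁅A, C⁆ := by
  simp only [Ring.lie_def, sub_mul, mul_sub]; abel

theorem smul_lie_smul_end {V : Type*} [AddCommGroup V] [Module ℂ V] (a b : ℂ)
    (A B : Module.End ℂ V) : ⁅a • A, b • B⁆ = (a * b) • ⁅A, B⁆ := by
  simp only [Ring.lie_def, smul_mul_smul_comm, smul_sub, mul_comm b a]

theorem lie_zero_end {V : Type*} [AddCommGroup V] [Module ℂ V] (A : Module.End ℂ V) :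
    ⁅A, (0 : Module.End ℂ V)⁆ = 0 := by
  simp [Ring.lie_def]

theorem lie_coroot_raise (s t : ℤ) :
    ⁅coroot M s, raise M t⁆ = (cartanInf s t : ℂ) • raise M t := by
  simp only [coroot, raise, sub_lie_end, lie_unitOp, cartanInf]
  rcases lt_trichotomy s t with h | rfl | h
  · by_cases h' : t = s + 1
    · subst h'
      simp [show s ≠ s + 1 + 1 by omega]
      module
    · simp [h.ne, h', Ne.symm h', show s ≠ t + 1 by omega]
  · simp [two_smul]
  · by_cases h' : s = t + 1
    · subst h'
      simp [show t + 1 + 1 ≠ t by omega]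
      module
    · simp [h', show t ≠ s + 1 by omega, show s ≠ t by omega, show s + 1 ≠ t by omega]

theorem lie_coroot_lower (s t : ℤ) :
    ⁅coroot M s, lower M t⁆ = (-1 * (cartanInf s t : ℂ)) • lower M t := by
  simp only [coroot, lower, sub_lie_end, lie_unitOp, cartanInf]
  rcases lt_trichotomy s t with h | rfl | h
  · by_cases h' : t = s + 1
    · subst h'
      simp [show s ≠ s + 1 + 1 by omega]
    · simp [h.ne, h', Ne.symm h', show s ≠ t + 1 by omega]
  · simp
    module
  · by_cases h' : s = t + 1
    · subst h'
      simp [show t + 1 + 1 ≠ t by omega]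
    · simp [h', show t ≠ s + 1 by omega, show s ≠ t by omega, show s + 1 ≠ t by omega]

theorem lie_coroot_coroot (s t : ℤ) : ⁅coroot M s, coroot M t⁆ = 0 := by
  have h : ∀ a b : ℤ, ⁅(unitOp a a : Module.End ℂ (Fock M)),
      (unitOp b b : Module.End ℂ (Fock M))⁆ = 0 := by
    intro a b
    rw [lie_unitOp]
    by_cases h : a = b <;> simp [h]
  simp [coroot, sub_lie_end, lie_sub_end, h]

/-- A family of operators indexed by the nodes of the Dynkin diagram of type `A_∞` that satisfies
the commutation relations of Chevalley generators away from neighbouring nodes. -/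
structure ChevalleyLike (A : ℤ → Module.End ℂ (Fock M)) : Prop where
  locFin : LocFin A
  lie_eq_zero : ∀ s t, t ≠ s + 1 → s ≠ t + 1 → ⁅A s, A t⁆ = 0
  lie_lie_eq_zero : ∀ s s' t, (s = s' ∨ 3 ≤ |s - s'|) → ⁅A s, ⁅A s', A t⁆⁆ = 0

/-- An inner bracket is, up to sign, a matrix unit spanning two adjacent steps, and the outer one
extends it only if `|s - s'|` is 1 or 2. The hypothesis excludes just these distances. -/
theorem chevalleyLike_raise : ChevalleyLike (raise M) where
  locFin := locFin_raise
  lie_eq_zero s t h h' := by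
    rw [raise, raise, lie_unitOp, if_neg (by omega), if_neg (by omega), sub_zero]
  lie_lie_eq_zero s s' t h := by
    have h1 : s ≠ s' + 2 ∧ s' ≠ s + 2 ∧ s ≠ s' + 1 ∧ s' ≠ s + 1 := by
      rcases h with h | h <;> grind
    simp only [raise, lie_unitOp]
    split_ifs <;> simp only [sub_zero, lie_zero_end, lie_sub_end, lie_unitOp] <;>
      grind

theorem chevalleyLike_lower : ChevalleyLike (lower M) where
  locFin := locFin_lower
  lie_eq_zero s t h h' := by
    rw [lower, lower, lie_unitOp, if_neg (by omega), if_neg (by omega), sub_zero]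
  lie_lie_eq_zero s s' t h := by
    have h1 : s ≠ s' + 2 ∧ s' ≠ s + 2 ∧ s ≠ s' + 1 ∧ s' ≠ s + 1 := by
      rcases h with h | h <;> grind
    simp only [lower, lie_unitOp]
    split_ifs <;> simp only [sub_zero, lie_zero_end, lie_sub_end, lie_unitOp] <;>
      grind

/-! ### Weighted sums over a residue class -/

/-- The coefficient `x_s ^ k` with `x_s = κ ^ (1 - s)`, on the residue class of `i`. -/
noncomputable def wt (n : ℕ) (κ : ℂ) (i : ZMod n) (k s : ℤ) : ℂ :=
  if (s : ZMod n) = i then κ ^ ((1 - s) * k) else 0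

/-- The sum of the `x_s ^ k • A s` over the residue class of `i`. -/
noncomputable def wsum (n : ℕ) (κ : ℂ) (A : ℤ → Module.End ℂ (Fock M)) (i : ZMod n) (k : ℤ) :
    Module.End ℂ (Fock M) :=
  lsum fun s => wt n κ i k s • A s

variable {n : ℕ} {κ : ℂ}

theorem zmod_one_ne_zero (hn : 3 ≤ n) : (1 : ZMod n) ≠ 0 := by
  have : Fact (1 < n) := ⟨by omega⟩
  exact one_ne_zero

theorem zmod_two_ne_zero (hn : 3 ≤ n) : (2 : ZMod n) ≠ 0 := by
  intro h
  have := (ZMod.natCast_eq_zero_iff 2 n).1 (by exact_mod_cast h)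
  have := Nat.le_of_dvd (by norm_num) this
  omega

theorem three_le_abs_sub (hn : 3 ≤ n) {s t : ℤ} (h : (s : ZMod n) = t) :
    s = t ∨ 3 ≤ |s - t| := by
  by_cases hst : s = t
  · exact Or.inl hst
  · have h1 := (ZMod.intCast_eq_intCast_iff_dvd_sub t s n).1 h.symm
    have := Int.le_of_dvd (abs_pos.2 (sub_ne_zero.2 hst)) ((dvd_abs _ _).2 h1)
    right
    omega

/-- The Cartan integers of type `A_∞` sum up to those of type `A^{(1)}_{n-1}`. -/
theorem exists_wt_mul_cartanInf (hn : 3 ≤ n) (hκ : κ ≠ 0) (i j : ZMod n) (k : ℤ) :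
    ∃ r : ℤ, ∀ s t : ℤ, (s : ZMod n) = j → wt n κ i k t * cartanInf t s =
      if t = s + r then (cartan n i j : ℂ) * κ ^ (-(k * mMat n i j)) * κ ^ ((1 - s) * k)
      else 0 := by
  have h1 := zmod_one_ne_zero hn
  have h2 := zmod_two_ne_zero hn
  have h11 : (1 : ZMod n) + 1 ≠ 0 := by rwa [one_add_one_eq_two]
  have hm1 : (-1 : ZMod n) ≠ 1 := fun h => h11 (by linear_combination -h)
  by_cases hij : i = j
  · refine ⟨0, fun s t hs => ?_⟩
    subst hij hs
    rw [add_zero]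
    by_cases hts : t = s
    · subst hts
      simp [wt, cartan, cartanInf, mMat, h1, mul_comm]
    · rw [if_neg hts]
      by_cases h : (t : ZMod n) = s
      · rcases three_le_abs_sub hn h with h | h
        · exact absurd h hts
        · rw [cartanInf, if_neg hts, if_neg (by grind)]; simp
      · rw [wt, if_neg h, zero_mul]
  · by_cases hj : j = i + 1
    -- Of the two neighbours of `s` only `s - 1` lies in the class of `i`; having `s + 1` there too
    -- would force `2 = 0` in `ZMod n`.
    · refine ⟨-1, fun s t hs => ?_⟩
      by_cases hts : t = s + -1
      · subst hts
        have hi : (((s + -1 : ℤ)) : ZMod n) = i := by push_cast; rw [hs, hj]; ring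
        rw [wt, if_pos hi, if_pos rfl, cartanInf, if_neg (by omega), if_pos (by omega), cartan,
          if_neg hij, if_pos (Or.inl hj), mMat, if_pos hj, mul_assoc, ← zpow_add₀ hκ, mul_comm]
        congr 2
        ring
      · rw [if_neg hts]
        by_cases h : (t : ZMod n) = i
        · rw [cartanInf, if_neg, if_neg]
          · simp
          · rintro (rfl | h')
            · refine h11 ?_
              push_cast at h
              rw [hs, hj] at h
              linear_combination h
            · omega
          · rintro rfl
            exact hij (h.symm.trans hs)
        · rw [wt, if_neg h, zero_mul]
    · by_cases hi : i = j + 1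
      · refine ⟨1, fun s t hs => ?_⟩
        by_cases hts : t = s + 1
        · subst hts
          have hi' : (((s + 1 : ℤ)) : ZMod n) = i := by push_cast; rw [hs, hi]
          rw [wt, if_pos hi', if_pos rfl, cartanInf, if_neg (by omega), if_pos (by omega), cartan,
            if_neg hij, if_pos (Or.inr hi), mMat, if_neg hj, if_pos hi, mul_assoc,
            ← zpow_add₀ hκ, mul_comm]
          congr 2
          ring
        · rw [if_neg hts]
          by_cases h : (t : ZMod n) = i
          · rw [cartanInf, if_neg, if_neg]
            · simp
            · rintro (h' | rfl)
              · omega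
              · refine h11 ?_
                push_cast at hs
                rw [h, hi] at hs
                linear_combination hs
            · rintro rfl
              exact hij (h.symm.trans hs)
          · rw [wt, if_neg h, zero_mul]
      · refine ⟨0, fun s t hs => ?_⟩
        have hc : cartan n i j = 0 := by simp [cartan, hij, hj, hi]
        rw [hc]
        simp only [Int.cast_zero, zero_mul, ite_self]
        by_cases h : (t : ZMod n) = i
        · rw [cartanInf, if_neg, if_neg]
          · simp
          · rintro (rfl | rfl)
            · exact hi (by rw [← h, ← hs]; push_cast; rfl)
            · exact hj (by rw [← h, ← hs]; push_cast; rfl)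
          · rintro rfl
            exact hij (h.symm.trans hs)
        · rw [wt, if_neg h, zero_mul]

/-- For each `s` at most one `t` contributes, and there `x_t ^ k` is `κ ^ (-k m_{ij}) x_s ^ k`. The
sign `ε` treats raising and lowering operators together. -/
theorem lie_wsum_coroot (hn : 3 ≤ n) (hκ : κ ≠ 0) {A : ℤ → Module.End ℂ (Fock M)}
    (hA : LocFin A) (ε : ℂ) (h : ∀ s t, ⁅coroot M s, A t⁆ = (ε * cartanInf s t) • A t)
    (i j : ZMod n) (k l : ℤ) :
    ⁅wsum n κ (coroot M) i k, wsum n κ A j l⁆ =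
      (ε * (cartan n i j : ℂ) * κ ^ (-(k * mMat n i j))) • wsum n κ A j (k + l) := by
  obtain ⟨r, hr⟩ := exists_wt_mul_cartanInf hn hκ i j k
  have key : ∀ s t, ⁅wt n κ i k t • coroot M t, wt n κ j l s • A s⁆ =
      (if t = s + r then ε * (cartan n i j : ℂ) * κ ^ (-(k * mMat n i j)) * wt n κ j (k + l) s
        else 0) • A s := by
    intro s t
    rw [smul_lie_smul_end, h, smul_smul]
    congr 1
    by_cases hs : (s : ZMod n) = j
    · have e : wt n κ i k t * wt n κ j l s * (ε * cartanInf t s) =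
        ε * wt n κ j l s * (wt n κ i k t * cartanInf t s) := by ring
      rw [e, hr s t hs]
      split_ifs
      · rw [wt, if_pos hs, wt, if_pos hs, mul_add, zpow_add₀ hκ]
        ring
      · ring
    · simp [wt, hs]
  rw [wsum, wsum, wsum, ← lsum_smul (hA.smul _)]
  refine lie_lsum_eq (locFin_coroot.smul _) (hA.smul _) r (fun s => ?_) fun s t hts => ?_
  · rw [key, if_pos rfl, smul_smul]
  · rw [key, if_neg hts, zero_smul]

theorem lie_wsum_raise_lower (hκ : κ ≠ 0) (i j : ZMod n) (k l : ℤ) :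
    ⁅wsum n κ (raise M) i k, wsum n κ (lower M) j l⁆ =
      if i = j then wsum n κ (coroot M) i (k + l) else 0 := by
  split_ifs with h
  · subst h
    refine lie_lsum_eq (locFin_raise.smul _) (locFin_lower.smul _) 0 (fun s => ?_)
      fun s t hts => ?_
    · rw [add_zero, smul_lie_smul_end, lie_raise_lower_self]
      congr 1
      unfold wt
      split_ifs
      · rw [mul_add, zpow_add₀ hκ]
      · simp
    · rw [smul_lie_smul_end, lie_raise_lower_of_ne (by simpa using hts), smul_zero]
  · refine lie_lsum_eq_zero (locFin_raise.smul _) (locFin_lower.smul _) fun s t => ?_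
    rw [smul_lie_smul_end]
    by_cases hst : s = t
    · subst hst
      have : wt n κ i k s * wt n κ j l s = 0 := by
        unfold wt
        split_ifs with h1 h2
        · exact absurd (h1.symm.trans h2) h
        all_goals simp
      rw [this, zero_smul]
    · rw [lie_raise_lower_of_ne hst, smul_zero]

theorem lie_wsum_coroot_coroot (i j : ZMod n) (k l : ℤ) :
    ⁅wsum n κ (coroot M) i k, wsum n κ (coroot M) j l⁆ = 0 :=
  lie_lsum_eq_zero (locFin_coroot.smul _) (locFin_coroot.smul _) fun s t => by
    rw [smul_lie_smul_end, lie_coroot_coroot, smul_zero]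

namespace ChevalleyLike

variable {A : ℤ → Module.End ℂ (Fock M)}

/-- Only neighbours `s`, `t` fail to commute, and for them `κ ^ m_{ij} * x_s = x_t`. -/
theorem smul_lie_wsum (hA : ChevalleyLike A) (hn : 3 ≤ n) (hκ : κ ≠ 0) (i j : ZMod n) (k l : ℤ) :
    κ ^ mMat n i j • ⁅wsum n κ A i (k + 1), wsum n κ A j l⁆ =
      ⁅wsum n κ A i k, wsum n κ A j (l + 1)⁆ := by
  have h2 := zmod_two_ne_zero hn
  refine smul_lie_lsum_congr (hA.locFin.smul _) (hA.locFin.smul _) (hA.locFin.smul _)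
    (hA.locFin.smul _) _ fun s t => ?_
  rw [smul_lie_smul_end, smul_lie_smul_end, smul_smul]
  by_cases hz : t ≠ s + 1 ∧ s ≠ t + 1
  · rw [hA.lie_eq_zero s t hz.1 hz.2, smul_zero, smul_zero]
  congr 1
  unfold wt
  by_cases hs : (s : ZMod n) = i
  swap
  · simp [hs]
  by_cases ht : (t : ZMod n) = j
  swap
  · simp [ht]
  simp only [hs, ht, if_true]
  rw [← zpow_add₀ hκ, ← zpow_add₀ hκ, ← zpow_add₀ hκ]
  congr 1
  by_cases hts : t = s + 1
  · have hj : j = i + 1 := by rw [← hs, ← ht, hts]; push_cast; rfl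
    rw [mMat, if_pos hj, hts]
    ring
  · have hst : s = t + 1 := by
      by_contra h
      exact hz ⟨hts, h⟩
    have hi : i = j + 1 := by rw [← hs, ← ht, hst]; push_cast; rfl
    have hj : j ≠ i + 1 := by
      intro hj
      apply h2
      rw [hi] at hj
      linear_combination -hj
    rw [mMat, if_neg hj, if_pos hi, hst]
    ring

theorem lie_wsum_eq_zero (hA : ChevalleyLike A) (hn : 3 ≤ n) {i j : ZMod n}
    (h : cartan n i j = 0) (k l : ℤ) :
    ⁅wsum n κ A i k, wsum n κ A j l⁆ = 0 := by
  have h1 := zmod_one_ne_zero hn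
  refine lie_lsum_eq_zero (hA.locFin.smul _) (hA.locFin.smul _) fun s t => ?_
  rw [smul_lie_smul_end]
  by_cases hs : (s : ZMod n) = i
  swap
  · simp [wt, hs]
  by_cases ht : (t : ZMod n) = j
  swap
  · simp [wt, ht]
  rw [hA.lie_eq_zero, smul_zero]
  · rintro rfl
    push_cast at ht
    rw [hs] at ht
    simp [cartan, ← ht, h1] at h
  · rintro rfl
    push_cast at hs
    rw [ht] at hs
    simp [cartan, ← hs, h1] at h

/-- Two indices of one residue class are equal or at least 3 apart, so each term of the symmetrized
Serre relation vanishes by itself. -/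
theorem lie_lie_wsum_eq_zero (hA : ChevalleyLike A) (hn : 3 ≤ n) (i j : ZMod n) (k₁ k₂ l : ℤ) :
    ⁅wsum n κ A i k₁, ⁅wsum n κ A i k₂, wsum n κ A j l⁆⁆ = 0 := by
  refine lie_lie_lsum_eq_zero (hA.locFin.smul _) (hA.locFin.smul _) (hA.locFin.smul _)
    fun s s' t => ?_
  rw [smul_lie_smul_end, smul_lie_smul_end]
  by_cases hs : (s : ZMod n) = i
  swap
  · simp [wt, hs]
  by_cases hs' : (s' : ZMod n) = i
  swap
  · simp [wt, hs']
  rw [hA.lie_lie_eq_zero s s' t (three_le_abs_sub hn (hs.trans hs'.symm)), smul_zero]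

end ChevalleyLike

/-! ### One-particle operators -/

theorem eps_eq_iff (hn : 0 < n) {b : ℤ} (hb : 1 ≤ b) (hbn : b ≤ n) (t : ℤ) :
    eps n t = b ↔ (t : ZMod n) = (b : ZMod n) := by
  have hn' : (0 : ℤ) < n := by exact_mod_cast hn
  rw [ZMod.intCast_eq_intCast_iff, eps]
  constructor
  · intro h
    have : t = b + n * ((t - 1) / n) := by
      have := Int.emod_add_mul_ediv (t - 1) n
      linarith
    rw [this]
    simp [Int.ModEq]
  · intro h
    have h1 : (t - 1) % n = (b - 1) % n :=
      Int.ModEq.sub_right 1 (by simpa [Int.ModEq] using h)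
    rw [h1, Int.emod_eq_of_lt (by omega) (by omega)]
    ring

theorem matUnit_u (a b t : ℤ) :
    matUnit n a b (u t) = if eps n t = b then u (t + a - b) else 0 := by
  simp [matUnit, u]

theorem zPow_u (r t : ℤ) : zPow n r (u t) = u (t - n * r) := by
  simp [zPow, u]

theorem pD_u (p : ℂ) (r t : ℤ) : pD n p r (u t) = p ^ (r * lev n t) • u t := by
  simp [pD, u]

/-- The node 0 is not exceptional in the basis `u_t`: the factor `z` turns the step `v_1 ↦ v_n` into
`t ↦ t - 1`. -/
theorem opE_u (hn : 3 ≤ n) (i : ZMod n) (t : ℤ) :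
    opE n i (u t) = if (t : ZMod n) = i + 1 then u (t - 1) else 0 := by
  have : NeZero n := ⟨by omega⟩
  unfold opE
  split_ifs with hi h h
  · rw [Module.End.mul_apply, matUnit_u, if_pos, zPow_u]
    · congr 1; ring
    · rw [eps_eq_iff (by omega) le_rfl (by omega), h, hi]; simp
  · rw [Module.End.mul_apply, matUnit_u, if_neg, map_zero]
    rw [eps_eq_iff (by omega) le_rfl (by omega)]
    simpa [hi] using h
  all_goals
    have hlt := ZMod.val_lt i
    have hcast : (((i.val : ℤ) + 1 : ℤ) : ZMod n) = i + 1 := by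
      push_cast; rw [ZMod.natCast_zmod_val]
  · rw [matUnit_u, if_pos]
    · congr 1; ring
    · rw [eps_eq_iff (by omega) (by omega) (by omega), h, hcast]
  · rw [matUnit_u, if_neg]
    rwa [eps_eq_iff (by omega) (by omega) (by omega), hcast]

theorem opF_u (hn : 3 ≤ n) (i : ZMod n) (t : ℤ) :
    opF n i (u t) = if (t : ZMod n) = i then u (t + 1) else 0 := by
  have : NeZero n := ⟨by omega⟩
  unfold opF
  split_ifs with hi h h
  · rw [Module.End.mul_apply, matUnit_u, if_pos, zPow_u]
    · congr 1; ring
    · rw [eps_eq_iff (by omega) (by omega) le_rfl, h, hi]; simp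
  · rw [Module.End.mul_apply, matUnit_u, if_neg, map_zero]
    rw [eps_eq_iff (by omega) (by omega) le_rfl]
    simpa [hi] using h
  all_goals
    have hlt := ZMod.val_lt i
    have hpos : i.val ≠ 0 := by simpa using hi
    have hcast : ((i.val : ℤ) : ZMod n) = i := by
      push_cast; rw [ZMod.natCast_zmod_val]
  · rw [matUnit_u, if_pos]
    · congr 1; ring
    · rw [eps_eq_iff (by omega) (by omega) (by omega), h, hcast]
  · rw [matUnit_u, if_neg]
    rwa [eps_eq_iff (by omega) (by omega) (by omega), hcast]

theorem lev_of_eq_one_add (hn : 0 < n) (q r : ℤ) (hr : 0 ≤ r) (hrn : r < n) :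
    lev n (1 + n * q + r) = -q := by
  have hn' : (0 : ℤ) < n := by exact_mod_cast hn
  rw [lev, show 1 + (n : ℤ) * q + r - 1 = r + n * q by ring, Int.add_mul_ediv_left _ _ hn'.ne',
    Int.ediv_eq_zero_of_lt hr hrn, zero_add]

theorem exists_eq_one_add {t : ℤ} (h : (t : ZMod n) = 1) : ∃ q : ℤ, t = 1 + n * q := by
  obtain ⟨q, hq⟩ := (ZMod.intCast_eq_intCast_iff_dvd_sub 1 t n).1 (by simpa using h.symm)
  exact ⟨q, by linarith⟩

/-- For `t = 1 + n q` the level is `-q`, and `E^{n,1}` keeps it. Hence `p^{-D}` contributes `p ^ q =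
κ ^ (-n q) = x_t`. -/
theorem pD_mul_matUnit_u (hn : 3 ≤ n) {p : ℂ} (hκ : κ ^ n = p⁻¹) (t : ℤ) :
    (pD n p (-1) * matUnit n n 1) (u t) = wt n κ 1 1 t • u (t + (n - 1)) := by
  rw [Module.End.mul_apply, matUnit_u, wt]
  by_cases h : (t : ZMod n) = 1
  · rw [if_pos, if_pos h, pD_u, add_sub_assoc]
    · obtain ⟨q, rfl⟩ := exists_eq_one_add h
      rw [lev_of_eq_one_add (by omega) q _ (by omega) (by omega)]
      congr 1
      rw [show (1 - (1 + (n : ℤ) * q)) * 1 = n * -q by ring, zpow_mul κ, zpow_natCast, hκ,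
        inv_zpow', neg_neg]
      congr 1; ring
    · rw [eps_eq_iff (by omega) le_rfl (by omega), h]; simp
  · rw [if_neg, if_neg h, map_zero, zero_smul]
    rw [eps_eq_iff (by omega) le_rfl (by omega)]
    simpa using h

theorem pD_mul_matUnit_u' (hn : 3 ≤ n) {p : ℂ} (hκ : κ ^ n = p⁻¹) (t : ℤ) :
    (pD n p 1 * matUnit n 1 n) (u t) =
      wt n κ 1 (-1) (t - (n - 1)) • u (t - (n - 1)) := by
  have hcast : ((t - (n - 1) : ℤ) : ZMod n) = t + 1 := by simp
  rw [Module.End.mul_apply, matUnit_u, wt]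
  by_cases h : (t : ZMod n) = 0
  · have h' : ((t - (n - 1) : ℤ) : ZMod n) = 1 := by rw [hcast, h, zero_add]
    rw [if_pos, if_pos h', pD_u, show t + 1 - (n : ℤ) = t - (n - 1) by ring]
    · obtain ⟨q, hq⟩ := exists_eq_one_add h'
      rw [hq, show 1 + (n : ℤ) * q = 1 + n * q + 0 by ring,
        lev_of_eq_one_add (by omega) q 0 le_rfl (by omega)]
      congr 1
      rw [show (1 - (1 + (n : ℤ) * q + 0)) * (-1) = n * q by ring, zpow_mul κ, zpow_natCast, hκ,
        inv_zpow']
      congr 1; ring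
    · rw [eps_eq_iff (by omega) (by omega) le_rfl, h]; simp
  · rw [if_neg, if_neg, map_zero, zero_smul]
    · rw [hcast]
      simpa using h
    · rw [eps_eq_iff (by omega) (by omega) le_rfl]
      simpa using h

theorem actsBy_raise (hn : 3 ≤ n) (i : ZMod n) :
    ActsBy (wsum n κ (raise M) i 0) (opE n i) := by
  have h := actsBy_lsum (M := M) (a := 0) (b := 1) (by norm_num) (wt n κ i 0) (X := opE n i)
    fun t => by
      rw [opE_u hn, wt]
      simp [sub_eq_iff_eq_add]
  simp only [add_zero] at h
  exact h

theorem actsBy_lower (hn : 3 ≤ n) (i : ZMod n) :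
    ActsBy (wsum n κ (lower M) i 0) (opF n i) := by
  have h := actsBy_lsum (M := M) (a := 1) (b := 0) (by norm_num) (wt n κ i 0) (X := opF n i)
    fun t => by
      rw [opF_u hn, wt]
      simp
  simp only [add_zero] at h
  exact h

theorem actsBy_vertE0 (hn : 3 ≤ n) {p : ℂ} (hκ : κ ^ n = p⁻¹) :
    ActsBy (M := M) (lsum fun s => wt n κ 1 1 s • unitOp (s + (n - 1)) s)
      (pD n p (-1) * matUnit n n 1) := by
  have h := actsBy_lsum (M := M) (a := n - 1) (b := 0) (by omega) (wt n κ 1 1)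
    (X := pD n p (-1) * matUnit n n 1) fun t => by
      rw [pD_mul_matUnit_u hn hκ, sub_zero]
  simp only [add_zero] at h
  exact h

theorem actsBy_vertF0 (hn : 3 ≤ n) {p : ℂ} (hκ : κ ^ n = p⁻¹) :
    ActsBy (M := M) (lsum fun s => wt n κ 1 (-1) s • unitOp s (s + (n - 1)))
      (pD n p 1 * matUnit n 1 n) := by
  have h := actsBy_lsum (M := M) (a := 0) (b := n - 1) (by omega) (wt n κ 1 (-1))
    (X := pD n p 1 * matUnit n 1 n) fun t => by
      rw [pD_mul_matUnit_u' hn hκ, add_zero]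
  simp only [add_zero] at h
  exact h

/-! ### The action on the Fock space -/

theorem map_lie_of_algHom {A B : Type*} [Ring A] [Ring B] [Algebra ℂ A] [Algebra ℂ B]
    (f : A →ₐ[ℂ] B) (x y : A) : f ⁅x, y⁆ = ⁅f x, f y⁆ := by
  simp [Ring.lie_def]

/-- The operators by which the generators act on the Fock space. -/
noncomputable def genOp (n : ℕ) (κ : ℂ) (M : ℤ) : Gen n → Module.End ℂ (Fock M)
  | .E i k => wsum n κ (raise M) i k
  | .F i k => wsum n κ (lower M) i k
  | .H i k => wsum n κ (coroot M) i k
  | .c => 0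

theorem lift_genOp_gen (g : Gen n) : FreeAlgebra.lift ℂ (genOp n κ M) (gen g) = genOp n κ M g :=
  FreeAlgebra.lift_ι_apply _ _

theorem genOp_rel (hn : 3 ≤ n) (hκ : κ ≠ 0) ⦃x y : Free n⦄ (h : TorRel n κ x y) :
    FreeAlgebra.lift ℂ (genOp n κ M) x = FreeAlgebra.lift ℂ (genOp n κ M) y := by
  cases h with
  | central g => simp [Ring.lie_def, lift_genOp_gen, genOp]
  | HH i j k l =>
    rw [map_lie_of_algHom, lift_genOp_gen, lift_genOp_gen]
    simp only [genOp]
    rw [lie_wsum_coroot_coroot]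
    split_ifs <;> simp [lift_genOp_gen, genOp]
  | HE i j k l =>
    rw [map_lie_of_algHom, map_smul, lift_genOp_gen, lift_genOp_gen, lift_genOp_gen]
    simp only [genOp]
    rw [lie_wsum_coroot hn hκ locFin_raise 1 fun s t => by rw [one_mul, lie_coroot_raise], one_mul]
  | HF i j k l =>
    rw [map_lie_of_algHom, map_smul, lift_genOp_gen, lift_genOp_gen, lift_genOp_gen]
    simp only [genOp]
    rw [lie_wsum_coroot hn hκ locFin_lower (-1) lie_coroot_lower, neg_one_mul]
  | EF i j k l =>
    rw [map_lie_of_algHom, lift_genOp_gen, lift_genOp_gen]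
    simp only [genOp]
    rw [lie_wsum_raise_lower hκ]
    split_ifs <;> simp [lift_genOp_gen, genOp]
  | EE i j k l =>
    simp only [map_smul, map_lie_of_algHom, lift_genOp_gen, genOp]
    exact chevalleyLike_raise.smul_lie_wsum hn hκ i j k l
  | FF i j k l =>
    simp only [map_smul, map_lie_of_algHom, lift_genOp_gen, genOp]
    exact chevalleyLike_lower.smul_lie_wsum hn hκ i j k l
  | serreE₁ i j h k l =>
    simp only [map_zero, map_lie_of_algHom, lift_genOp_gen, genOp]
    exact chevalleyLike_raise.lie_wsum_eq_zero hn h k l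
  | serreF₁ i j h k l =>
    simp only [map_zero, map_lie_of_algHom, lift_genOp_gen, genOp]
    exact chevalleyLike_lower.lie_wsum_eq_zero hn h k l
  | serreE₂ i j h k₁ k₂ l =>
    simp only [map_zero, map_add, map_lie_of_algHom, lift_genOp_gen, genOp]
    rw [chevalleyLike_raise.lie_lie_wsum_eq_zero hn, chevalleyLike_raise.lie_lie_wsum_eq_zero hn,
      add_zero]
  | serreF₂ i j h k₁ k₂ l =>
    simp only [map_zero, map_add, map_lie_of_algHom, lift_genOp_gen, genOp]
    rw [chevalleyLike_lower.lie_lie_wsum_eq_zero hn, chevalleyLike_lower.lie_lie_wsum_eq_zero hn,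
      add_zero]

/-- The action of the toroidal algebra on the Fock space. -/
noncomputable def fockAction (M : ℤ) (hn : 3 ≤ n) (hκ : κ ≠ 0) :
    Tor n κ →ₐ[ℂ] Module.End ℂ (Fock M) :=
  RingQuot.liftAlgHom ℂ ⟨FreeAlgebra.lift ℂ (genOp n κ M), genOp_rel hn hκ⟩

theorem fockAction_tor (hn : 3 ≤ n) (hκ : κ ≠ 0) (g : Gen n) :
    fockAction M hn hκ (tor n κ g) = genOp n κ M g := by
  rw [fockAction, tor, RingQuot.liftAlgHom_mkAlgHom_apply, lift_genOp_gen]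

/-! ### Vertical generators as iterated brackets -/

theorem natCast_zmod_ne_zero {r : ℕ} (h0 : 0 < r) (hr : r < n) : (r : ZMod n) ≠ 0 := by
  intro h
  have := Nat.le_of_dvd h0 ((ZMod.natCast_eq_zero_iff r n).1 h)
  omega

/-- Each bracket lengthens the matrix unit by one step: from `s ≡ 1` the next step starts at `s + r
+ 1 ≡ r + 2`. Attachment at the other end would require `r + 2 ≡ 0`, impossible before the cycle
closes. -/
theorem fockAction_nestF (hn : 3 ≤ n) (hκ : κ ≠ 0) (r : ℕ) (hr : r + 2 ≤ n) :
    fockAction M hn hκ (nestF n κ r) =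
      lsum fun s => wt n κ 1 1 s • unitOp (s + (r + 1)) s := by
  induction r with
  | zero =>
    rw [nestF, fockAction_tor]
    simp [genOp, wsum, lower]
  | succ r ih =>
    rw [nestF, map_lie_of_algHom, ih (by omega), fockAction_tor]
    simp only [genOp, wsum]
    have hloc : LocFin fun s => (unitOp (s + ((r : ℤ) + 1)) s : Module.End ℂ (Fock M)) := by
      simpa only [add_zero] using locFin_unitOp (M := M) (a := (r : ℤ) + 1) (b := 0) (by omega)
    refine lie_lsum_eq (locFin_lower.smul _) (hloc.smul _) (r + 1) (fun s => ?_)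
      fun s t ht => ?_
    · rw [smul_lie_smul_end, lower, lie_unitOp, if_pos rfl, if_neg (by omega), sub_zero]
      unfold wt
      split_ifs with h1 h2 h2
      · simp [add_assoc]
      · simp
      · exact absurd (by push_cast; rw [h2]; ring) h1
      · simp
    · rw [smul_lie_smul_end, lower, lie_unitOp, if_neg (by omega)]
      by_cases hts : t + 1 = s
      · have : wt n κ ((r + 2 : ℕ) : ZMod n) 0 t * wt n κ 1 1 s = 0 := by
          unfold wt
          split_ifs with h1 h2
          · refine absurd ?_ (natCast_zmod_ne_zero (n := n) (r := r + 2) (by omega) (by omega))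
            rw [← hts] at h2
            push_cast at h1 h2 ⊢
            linear_combination h2 - h1
          all_goals simp
        rw [this, zero_smul]
      · rw [if_neg hts, sub_zero, smul_zero]

theorem fockAction_nestE (hn : 3 ≤ n) (hκ : κ ≠ 0) (r : ℕ) (hr : r + 2 ≤ n) :
    fockAction M hn hκ (nestE n κ r) =
      lsum fun s => wt n κ 1 (-1) s • unitOp s (s + (r + 1)) := by
  induction r with
  | zero =>
    rw [nestE, fockAction_tor]
    simp [genOp, wsum, raise]
  | succ r ih =>
    rw [nestE, map_lie_of_algHom, ih (by omega), fockAction_tor]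
    simp only [genOp, wsum]
    have hloc : LocFin fun s => (unitOp s (s + ((r : ℤ) + 1)) : Module.End ℂ (Fock M)) := by
      simpa only [add_zero] using locFin_unitOp (M := M) (a := 0) (b := (r : ℤ) + 1) (by omega)
    refine lie_lsum_eq' (hloc.smul _) (locFin_raise.smul _) (r + 1) (fun s => ?_)
      fun s t ht => ?_
    · rw [smul_lie_smul_end, raise, lie_unitOp, if_pos rfl, if_neg (by omega), sub_zero]
      unfold wt
      split_ifs with h1 h2 h2
      · simp [add_assoc]
      · exact absurd (by push_cast; rw [h1]; ring) h2
      · simp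
      · simp
    · rw [smul_lie_smul_end, raise, lie_unitOp, if_neg (by omega)]
      by_cases hts : s = t + 1
      · have : wt n κ 1 (-1) s * wt n κ ((r + 2 : ℕ) : ZMod n) 0 t = 0 := by
          unfold wt
          split_ifs with h1 h2
          · refine absurd ?_ (natCast_zmod_ne_zero (n := n) (r := r + 2) (by omega) (by omega))
            rw [hts] at h1
            push_cast at h1 h2 ⊢
            linear_combination h1 - h2
          all_goals simp
        rw [this, zero_smul]
      · rw [if_neg hts, sub_zero, smul_zero]

/-! ### Matrix units on wedges without repetition, and the vacuum -/

theorem unitOp_wedge_apply (a : ℤ) {k : Seq M} (hk : Function.Injective k.1) (j : ℕ) :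
    unitOp a (k.1 j) (wedge k) = wedge (k.replace j a) := by
  have h0 : ∀ i, i ≠ j → unitTerm a (k.1 j) k i = 0 := fun i hi => if_neg fun h => hi (hk h)
  rw [unitOp_wedge, finsum_eq_single _ j h0, unitTerm, if_pos rfl]

theorem unitOp_wedge_eq_zero (a : ℤ) {b : ℤ} {k : Seq M} (h : ∀ j, k.1 j ≠ b) :
    unitOp a b (wedge k) = 0 := by
  rw [unitOp_wedge]
  exact finsum_eq_zero_of_forall_eq_zero fun j => if_neg (h j)

theorem Seq.replace_self (k : Seq M) (j : ℕ) : k.replace j (k.1 j) = k :=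
  Seq.ext_apply fun i => by rw [Seq.replace_apply]; split_ifs with h <;> simp [h]

theorem unitOp_self_wedge {k : Seq M} (hk : Function.Injective k.1) (b : ℤ)
    [Decidable (∃ j, k.1 j = b)] :
    unitOp b b (wedge k) = if ∃ j, k.1 j = b then wedge k else 0 := by
  split_ifs with h
  · obtain ⟨j, rfl⟩ := h
    rw [unitOp_wedge_apply _ hk, Seq.replace_self]
  · push Not at h
    exact unitOp_wedge_eq_zero _ h

/-- The index sequence of the vacuum. -/
def vacSeq (M : ℤ) : Seq M := ⟨fun i => M - i, Filter.Eventually.of_forall fun _ => rfl⟩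

theorem vacSeq_apply (M : ℤ) (i : ℕ) : (vacSeq M).1 i = M - i := rfl

theorem vac_eq_wedge (M : ℤ) : vac M = wedge (vacSeq M) := rfl

theorem unitOp_self_vac (b : ℤ) : unitOp b b (vac M) = if b ≤ M then vac M else 0 := by
  classical
  have hinj : Function.Injective (vacSeq M).1 := fun i j h => by
    rw [vacSeq_apply, vacSeq_apply] at h
    omega
  have h : (∃ j, (vacSeq M).1 j = b) ↔ b ≤ M := by
    refine ⟨?_, fun h => ⟨(M - b).toNat, by rw [vacSeq_apply]; omega⟩⟩
    rintro ⟨j, rfl⟩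
    rw [vacSeq_apply]
    omega
  rw [vac_eq_wedge, unitOp_self_wedge hinj]
  simp only [h]

/-- The occupation numbers of the vacuum jump only between `M` and `M + 1`. -/
theorem coroot_vac (s : ℤ) : coroot M s (vac M) = if s = M then vac M else 0 := by
  rw [coroot, LinearMap.sub_apply, unitOp_self_vac, unitOp_self_vac]
  rcases lt_trichotomy s M with h | h | h
  · simp [h.le, h.ne, show s + 1 ≤ M by omega]
  · simp [h]
  · simp [h.ne', show ¬ s ≤ M by omega, show ¬ s + 1 ≤ M by omega]

theorem isFockAction_fockAction (hn : 3 ≤ n) {p : ℂ} (hκ0 : κ ≠ 0) (hκ : κ ^ n = p⁻¹) :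
    IsFockAction n p κ M (fockAction M hn hκ0) where
  E i := by
    rw [fockAction_tor]
    exact actsBy_raise hn i
  F i := by
    rw [fockAction_tor]
    exact actsBy_lower hn i
  H i := by
    rw [fockAction_tor]
    simp only [genOp, wsum]
    rw [lsum_apply (locFin_coroot.smul _), finsum_eq_single _ M]
    · rw [LinearMap.smul_apply, coroot_vac, if_pos rfl, wt]
      split_ifs <;> simp
    · intro s hs
      simp [coroot_vac, hs]
  e0 := by
    rw [vertE0, fockAction_nestF hn hκ0 _ (by omega)]
    have : ((n - 2 : ℕ) : ℤ) + 1 = n - 1 := by omega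
    rw [this]
    exact actsBy_vertE0 hn hκ
  f0 := by
    rw [vertF0, fockAction_nestE hn hκ0 _ (by omega)]
    have : ((n - 2 : ℕ) : ℤ) + 1 = n - 1 := by omega
    rw [this]
    exact actsBy_vertF0 hn hκ
  c := by rw [fockAction_tor]; rfl

/-! ### Operators preserving a subspace -/

section Preserves

variable {V : Type*} [AddCommGroup V] [Module ℂ V]

/-- `T` maps `W` into itself. -/
def Preserves (W : Submodule ℂ V) (T : Module.End ℂ V) : Prop := ∀ v ∈ W, T v ∈ W

variable {W : Submodule ℂ V} {S T : Module.End ℂ V}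

theorem Preserves.lie (hS : Preserves W S) (hT : Preserves W T) : Preserves W ⁅S, T⁆ :=
  fun v hv => W.sub_mem (hS _ (hT v hv)) (hT _ (hS v hv))

theorem Preserves.of_smul {c : ℂ} (hc : c ≠ 0) (h : Preserves W (c • T)) : Preserves W T :=
  fun v hv => (W.smul_mem_iff hc).1 (h v hv)

/-- Vandermonde separation: linear combinations of powers give all polynomials, among them the
Lagrange polynomial of the node `x s`. -/
theorem mem_of_forall_sum_pow_mem {ι : Type*} {S : Finset ι} {x : ι → ℂ} {w : ι → V}
    (hx : Set.InjOn x S) (h : ∀ l : ℕ, ∑ s ∈ S, x s ^ l • w s ∈ W) {s : ι} (hs : s ∈ S) :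
    w s ∈ W := by
  classical
  have hP : ∀ P : Polynomial ℂ, ∑ s ∈ S, P.eval (x s) • w s ∈ W := by
    intro P
    have : ∑ s ∈ S, P.eval (x s) • w s =
        ∑ l ∈ Finset.range (P.natDegree + 1), P.coeff l • ∑ s ∈ S, x s ^ l • w s := by
      simp only [Polynomial.eval_eq_sum_range, Finset.sum_smul, Finset.smul_sum, mul_smul]
      exact Finset.sum_comm
    rw [this]
    exact W.sum_mem fun l _ => W.smul_mem _ (h l)
  have := hP (Lagrange.basis S x s)
  rwa [Finset.sum_eq_single_of_mem s hs, Lagrange.eval_basis_self hx hs, one_smul] at this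
  intro t ht hts
  rw [Lagrange.eval_basis_of_ne hts.symm ht, zero_smul]

end Preserves

/-! ### Recovering the generators of gl_∞ -/

theorem preserves_of_forall_wsum {W : Submodule ℂ (Fock M)}
    {A : ℤ → Module.End ℂ (Fock M)} (hA : LocFin A)
    (hx : Function.Injective fun s : ℤ => κ ^ (1 - s)) {i : ZMod n}
    (h : ∀ l : ℕ, Preserves W (wsum n κ A i l)) {s : ℤ} (hs : (s : ZMod n) = i) :
    Preserves W (A s) := by
  classical
  intro v hv
  by_cases h0 : A s v = 0
  · rw [h0]; exact W.zero_mem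
  refine mem_of_forall_sum_pow_mem (S := (hA v).toFinset.filter fun s : ℤ => (s : ZMod n) = i)
    (x := fun s => κ ^ (1 - s)) (w := fun s => A s v) hx.injOn (fun l => ?_) (by simp [h0, hs])
  have := h l v hv
  rw [wsum, lsum_apply (hA.smul _), finsum_eq_sum_of_support_subset (s := (hA v).toFinset)] at this
  · rw [Finset.sum_filter]
    convert this using 2 with t
    rw [LinearMap.smul_apply, wt]
    split_ifs
    · rw [zpow_mul, zpow_natCast]
    · rw [zero_smul]
  · intro t ht
    simp only [Set.Finite.coe_toFinset, Function.mem_support]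
    intro h0
    exact ht (by simp [h0])

/-- In the class of `s + 1` every other index is at least 3 away from `s + 1`, so it neither equals
`s` nor neighbours it. Bracketing the whole sum with the coroot at `s` leaves one term, with
coefficient `-ε`. -/
theorem preserves_succ (hn : 3 ≤ n) {W : Submodule ℂ (Fock M)} {A : ℤ → Module.End ℂ (Fock M)}
    (hA : LocFin A) {ε : ℂ} (hε : ε ≠ 0)
    (h : ∀ s t, ⁅coroot M s, A t⁆ = (ε * cartanInf s t) • A t)
    (hW : ∀ i : ZMod n, Preserves W (wsum n κ A i 0)) {s : ℤ} (hs : Preserves W (coroot M s)) :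
    Preserves W (A (s + 1)) := by
  have h1 := hs.lie (hW ((s + 1 : ℤ) : ZMod n))
  rw [wsum, lie_lsum_right (hA.smul _), lsum_eq_single (s + 1)] at h1
  · rw [← one_smul ℂ (coroot M s), smul_lie_smul_end, h, smul_smul, wt, if_pos rfl] at h1
    refine h1.of_smul ?_
    simp [cartanInf, hε]
  · intro t ht
    rw [← one_smul ℂ (coroot M s), smul_lie_smul_end, h, smul_smul]
    by_cases hts : (t : ZMod n) = ((s + 1 : ℤ) : ZMod n)
    · rcases three_le_abs_sub hn hts with h | h
      · exact absurd h ht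
      · rw [cartanInf, if_neg (by grind), if_neg (by grind)]
        simp
    · rw [wt, if_neg hts]
      simp

/-- Bracketing with `H_{i,1}` shifts the mode by one, with factor `2ε`, since `m_{ii} = 0`. -/
theorem preserves_wsum_natCast (hn : 3 ≤ n) (hκ : κ ≠ 0) {W : Submodule ℂ (Fock M)}
    {A : ℤ → Module.End ℂ (Fock M)} (hA : LocFin A) {ε : ℂ} (hε : ε ≠ 0)
    (h : ∀ s t, ⁅coroot M s, A t⁆ = (ε * cartanInf s t) • A t) {i : ZMod n}
    (hH : Preserves W (wsum n κ (coroot M) i 1)) (h0 : Preserves W (wsum n κ A i 0)) (l : ℕ) :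
    Preserves W (wsum n κ A i l) := by
  induction l with
  | zero => exact h0
  | succ l ih =>
    have h1 := hH.lie ih
    rw [lie_wsum_coroot hn hκ hA ε h, add_comm] at h1
    refine h1.of_smul ?_
    simp [cartan, mMat, hε, zmod_one_ne_zero hn]

/-- This undoes the nested bracket: `E_{r+1,0}` cuts the top step off a matrix unit of length `r +
1`. Cutting at the bottom would need `r ≡ 0`. At `r = 1` the sum is `F_{1,1}`. -/
theorem preserves_lsum_unitOp (hn : 3 ≤ n) {W : Submodule ℂ (Fock M)}
    (hE : ∀ i : ZMod n, Preserves W (wsum n κ (raise M) i 0))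
    (he : Preserves W (lsum fun s => wt n κ 1 1 s • unitOp (s + (n - 1)) s)) (d : ℕ) :
    ∀ r : ℕ, 1 ≤ r → r + d = n - 1 →
      Preserves W (lsum fun s => wt n κ 1 1 s • unitOp (s + r) s) := by
  induction d with
  | zero =>
    intro r _ hr
    have : (r : ℤ) = n - 1 := by omega
    rwa [this]
  | succ d ih =>
    intro r hr hrd
    have h1 := (hE ((r + 1 : ℕ) : ZMod n)).lie (ih (r + 1) (by omega) (by omega))
    have hloc : LocFin fun s => (unitOp (s + ((r + 1 : ℕ) : ℤ)) s : Module.End ℂ (Fock M)) := by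
      simpa only [add_zero] using
        locFin_unitOp (M := M) (a := ((r + 1 : ℕ) : ℤ)) (b := 0) (by omega)
    rwa [wsum, lie_lsum_eq (locFin_raise.smul _) (hloc.smul _) r
      (C := fun s => wt n κ 1 1 s • unitOp (s + r) s) (fun s => ?_) fun s t ht => ?_] at h1
    · rw [smul_lie_smul_end, raise, lie_unitOp, if_pos (by push_cast; ring), if_neg (by omega),
        sub_zero]
      unfold wt
      split_ifs with h1 h2 h2
      · simp
      · simp
      · exact absurd (by push_cast; rw [h2]; ring) h1
      · simp
    · rw [smul_lie_smul_end, raise, lie_unitOp, if_neg (by push_cast; omega)]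
      by_cases hts : t = s
      · have : wt n κ ((r + 1 : ℕ) : ZMod n) 0 t * wt n κ 1 1 s = 0 := by
          unfold wt
          split_ifs with h1 h2
          · refine absurd ?_ (natCast_zmod_ne_zero (n := n) (r := r) (by omega) (by omega))
            rw [hts, h2] at h1
            push_cast at h1
            linear_combination -h1
          all_goals simp
        rw [this, zero_smul]
      · rw [if_neg hts, sub_zero, smul_zero]

theorem preserves_raise_lower (hn : 3 ≤ n) (hκ : κ ≠ 0)
    (hx : Function.Injective fun s : ℤ => κ ^ (1 - s)) {W : Submodule ℂ (Fock M)}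
    (hE : ∀ i : ZMod n, Preserves W (wsum n κ (raise M) i 0))
    (hF : ∀ i : ZMod n, Preserves W (wsum n κ (lower M) i 0))
    (he : Preserves W (lsum fun s => wt n κ 1 1 s • unitOp (s + (n - 1)) s)) (s : ℤ) :
    Preserves W (raise M s) ∧ Preserves W (lower M s) := by
  have hF1 : Preserves W (wsum n κ (lower M) 1 1) := by
    have := preserves_lsum_unitOp hn hE he (n - 2) 1 le_rfl (by omega)
    simpa [wsum, lower] using this
  have hH : Preserves W (wsum n κ (coroot M) 1 1) := by
    have := (hE 1).lie hF1
    rwa [lie_wsum_raise_lower hκ, if_pos rfl, zero_add] at this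
  have hr : ∀ s t, ⁅coroot M s, raise M t⁆ = (1 * (cartanInf s t : ℂ)) • raise M t := fun s t => by
    rw [one_mul, lie_coroot_raise]
  -- Interpolation works on the class of 1, and propagation only goes upwards; hence a starting
  -- point below `s` in that class.
  obtain ⟨b, hs, hbs⟩ : ∃ b : ℤ, (b : ZMod n) = 1 ∧ b ≤ s := by
    refine ⟨1 + n * ((s - 1) / n), by simp, ?_⟩
    have := Int.mul_ediv_self_le (x := s - 1) (k := n) (by omega)
    linarith
  induction s, hbs using Int.leInduction with
  | base =>
    exact ⟨preserves_of_forall_wsum locFin_raise hx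
        (preserves_wsum_natCast hn hκ locFin_raise one_ne_zero hr hH (hE 1)) hs,
      preserves_of_forall_wsum locFin_lower hx
        (preserves_wsum_natCast hn hκ locFin_lower (by norm_num) lie_coroot_lower hH (hF 1)) hs⟩
  | succ t _ ih =>
    have hc : Preserves W (coroot M t) := by
      rw [← lie_raise_lower_self]
      exact ih.1.lie ih.2
    exact ⟨preserves_succ hn locFin_raise one_ne_zero hr hE hc,
      preserves_succ hn locFin_lower (by norm_num) lie_coroot_lower hF hc⟩

/-! ### Irreducibility under the Chevalley generators of `gl_∞` -/

theorem exists_forall_unitOp_self_eq_zero (v : Fock M) :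
    ∃ N : ℤ, ∀ t ≥ N, unitOp t t v = 0 := by
  have hv : v ∈ Submodule.span ℂ (Set.range (wedge (M := M))) := by
    rw [span_range_wedge]; trivial
  induction hv using Submodule.span_induction with
  | mem v hv =>
    obtain ⟨k, rfl⟩ := hv
    obtain ⟨N, hN⟩ := k.exists_eq
    obtain ⟨B, hB⟩ := (Set.finite_lt_nat N).image k.1 |>.bddAbove
    refine ⟨max B M + 1, fun t ht => unitOp_wedge_eq_zero _ fun j hj => ?_⟩
    by_cases h : j < N
    · have : k.1 j ≤ B := hB ⟨j, h, rfl⟩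
      omega
    · have := hN j (by omega)
      omega
  | zero => exact ⟨0, by simp⟩
  | add v w _ _ hv hw =>
    obtain ⟨N, hN⟩ := hv
    obtain ⟨N', hN'⟩ := hw
    exact ⟨max N N', fun t ht => by
      rw [map_add, hN t (le_trans (le_max_left _ _) ht), hN' t (le_trans (le_max_right _ _) ht),
        add_zero]⟩
  | smul c v _ hv =>
    obtain ⟨N, hN⟩ := hv
    exact ⟨N, fun t ht => by rw [map_smul, hN t ht, smul_zero]⟩

/-- Coroots telescope: on a given vector, `unitOp s s` is the sum of the coroots at `t ≥ s`, a
finite sum because high levels are empty. -/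
theorem preserves_unitOp_self {W : Submodule ℂ (Fock M)}
    (h : ∀ s, Preserves W (coroot M s)) (s : ℤ) : Preserves W (unitOp s s) := by
  intro v hv
  obtain ⟨N, hN⟩ := exists_forall_unitOp_self_eq_zero v
  have key : ∀ (d : ℕ) (s : ℤ), N ≤ s + d → unitOp s s v ∈ W := by
    intro d
    induction d with
    | zero =>
      intro s hs
      rw [hN s (by simpa using hs)]
      exact W.zero_mem
    | succ d ih =>
      intro s hs
      have h1 := W.add_mem (h s v hv) (ih (s + 1) (by push_cast at hs; omega))
      rwa [coroot, LinearMap.sub_apply, sub_add_cancel] at h1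
  exact key (N - s).toNat s (by omega)

theorem span_wedge_strictAnti :
    Submodule.span ℂ (wedge '' {d : Seq M | StrictAnti d.1}) = ⊤ := by
  rw [eq_top_iff, ← span_range_wedge, Submodule.span_le]
  rintro _ ⟨k, rfl⟩
  rcases exists_strictAnti_or k with ⟨d, hd, h | h⟩ | h
  · rw [h]
    exact Submodule.subset_span ⟨d, hd, rfl⟩
  · rw [h]
    exact Submodule.neg_mem _ (Submodule.subset_span ⟨d, hd, rfl⟩)
  · rw [h]
    exact Submodule.zero_mem _

/-- A strictly decreasing sequence is determined by its range. -/
theorem Seq.exists_mem_range_iff {d d' : Seq M} (hd : StrictAnti d.1) (hd' : StrictAnti d'.1)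
    (h : d ≠ d') : ∃ s, ¬ ((∃ j, d.1 j = s) ↔ ∃ j, d'.1 j = s) := by
  by_contra! hall
  refine h (Subtype.ext ?_)
  have hneg : (fun j => -d.1 j) = fun j => -d'.1 j := by
    refine (StrictMono.range_inj (fun i j hij => neg_lt_neg (hd hij))
      fun i j hij => neg_lt_neg (hd' hij)).1 (Set.ext fun s => ?_)
    simpa [neg_eq_iff_eq_neg] using hall (-s)
  funext j
  exact neg_injective (congrFun hneg j)

/-- The operator `unitOp s s` projects onto the wedges that occupy `s`. An `s` occupied in only one
of two wedges splits the sum into two shorter ones, both in `W` and not both zero; linear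
independence of the wedges is not needed. -/
theorem exists_wedge_mem {W : Submodule ℂ (Fock M)} (hW : ∀ s, Preserves W (unitOp s s))
    (c : Seq M → ℂ) (S : Finset (Seq M)) : (∀ d ∈ S, StrictAnti d.1) →
      ∑ d ∈ S, c d • wedge d ∈ W → ∑ d ∈ S, c d • wedge d ≠ 0 →
      ∃ d : Seq M, StrictAnti d.1 ∧ wedge d ∈ W := by
  classical
  induction S using Finset.strongInduction with
  | H S ih =>
    intro hS hmem hne
    by_cases hcard : ∃ d ∈ S, ∃ d' ∈ S, d ≠ d'
    · obtain ⟨d, hd, d', hd', hdd⟩ := hcard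
      obtain ⟨s, hs⟩ := Seq.exists_mem_range_iff (hS d hd) (hS d' hd') hdd
      set P : Seq M → Prop := fun d => ∃ j, d.1 j = s with hP
      have h1 : unitOp s s (∑ d ∈ S, c d • wedge d) = ∑ d ∈ S with P d, c d • wedge d := by
        rw [map_sum, Finset.sum_filter]
        refine Finset.sum_congr rfl fun d hd => ?_
        rw [map_smul, unitOp_self_wedge (hS d hd).injective]
        split_ifs <;> simp
      have h2 := hW s _ hmem
      have h3 := Finset.sum_filter_add_sum_filter_not S P fun d => c d • wedge d
      rw [h1] at h2
      have h4 : ∑ d ∈ S with ¬ P d, c d • wedge d ∈ W := by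
        rw [← h3] at hmem
        exact (W.add_mem_iff_right h2).1 hmem
      have hss : S.filter P ⊂ S ∧ S.filter (fun d => ¬ P d) ⊂ S := by
        constructor <;> rw [Finset.filter_ssubset] <;> by_cases hPd : P d
        · exact ⟨d', hd', fun h => hs ⟨fun _ => h, fun _ => hPd⟩⟩
        · exact ⟨d, hd, hPd⟩
        · exact ⟨d, hd, not_not.2 hPd⟩
        · exact ⟨d', hd', fun h => hs ⟨fun h' => absurd h' hPd, fun h' => absurd h' h⟩⟩
      by_cases h0 : ∑ d ∈ S with P d, c d • wedge d = 0
      · rw [h0, zero_add] at h3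
        exact ih _ hss.2 (fun d hd => hS d (Finset.mem_filter.1 hd).1) h4 (h3 ▸ hne)
      · exact ih _ hss.1 (fun d hd => hS d (Finset.mem_filter.1 hd).1) h2 h0
    · push Not at hcard
      obtain ⟨d, hd⟩ : S.Nonempty := by
        rw [Finset.nonempty_iff_ne_empty]
        rintro rfl
        simp at hne
      have hSd : S = {d} := Finset.eq_singleton_iff_unique_mem.2 ⟨hd, fun d' hd' =>
        hcard d' hd' d hd⟩
      rw [hSd, Finset.sum_singleton] at hmem hne
      exact ⟨d, hS d hd, (W.smul_mem_iff (left_ne_zero_of_smul hne)).1 hmem⟩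

theorem Seq.sub_le_apply {d : Seq M} (hd : StrictAnti d.1) (i : ℕ) : M - i ≤ d.1 i := by
  obtain ⟨N, hN⟩ := d.exists_eq
  have h : ∀ m : ℕ, d.1 (i + m) + m ≤ d.1 i := by
    intro m
    induction m with
    | zero => simp
    | succ m ih =>
      have := hd (Nat.lt_succ_self (i + m))
      rw [← add_assoc]
      push_cast
      change d.1 (i + m + 1) < _ at this
      omega
  have h1 := h N
  rw [hN (i + N) (by omega)] at h1
  push_cast at h1
  omega

/-- At the last deviation from the vacuum the entry is too large and its successor is minimal, so
there is room to decrease it by one: a removable box of the partition. -/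
theorem Seq.exists_descent {d : Seq M} (hne : d ≠ vacSeq M) :
    ∃ j : ℕ, d.1 j ≠ M - j ∧ d.1 (j + 1) = M - (j + 1 : ℕ) := by
  by_contra! h
  obtain ⟨i, hi⟩ : ∃ i, d.1 i ≠ M - i := by
    by_contra! h'
    exact hne (Seq.ext_apply h')
  obtain ⟨N, hN⟩ := d.exists_eq
  have h2 : ∀ m : ℕ, d.1 (i + m) ≠ M - (i + m : ℕ) := by
    intro m
    induction m with
    | zero => exact hi
    | succ m ih => exact h _ ih
  exact h2 N (hN _ (by omega))

/-- Induction on the size of the partition, bounded strictly by `e`. A raising operator removes a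
box and the matching lowering operator restores it, so membership passes both ways. -/
theorem wedge_mem_iff_vac_mem {W : Submodule ℂ (Fock M)}
    (hr : ∀ s, Preserves W (raise M s)) (hl : ∀ s, Preserves W (lower M s)) (N e : ℕ) :
    ∀ d : Seq M, StrictAnti d.1 → (∀ i ≥ N, d.1 i = M - i) →
      ∑ i ∈ Finset.range N, (d.1 i - (M - i)) < e → (wedge d ∈ W ↔ vac M ∈ W) := by
  induction e with
  | zero =>
    intro d hd _ hlt
    refine absurd hlt (not_lt.2 ?_)
    exact Finset.sum_nonneg fun i _ => sub_nonneg.2 (Seq.sub_le_apply hd i)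
  | succ e ih =>
    intro d hd hN hlt
    by_cases hne : d = vacSeq M
    · rw [hne, vac_eq_wedge]
    obtain ⟨j, hj, hj1⟩ := Seq.exists_descent hne
    have hjN : j < N := by
      by_contra h
      exact hj (hN j (by omega))
    have hlej := Seq.sub_le_apply hd j
    set d' := d.replace j (d.1 j - 1) with hd'
    have hd'j : d'.1 j = d.1 j - 1 := by rw [hd', Seq.replace_apply, if_pos rfl]
    have hd'i : ∀ i, i ≠ j → d'.1 i = d.1 i := fun i hi => by
      rw [hd', Seq.replace_apply, if_neg hi]
    have hanti : StrictAnti d'.1 := by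
      refine strictAnti_nat_of_succ_lt fun i => ?_
      have h1 := hd (Nat.lt_succ_self i)
      change d.1 (i + 1) < d.1 i at h1
      rcases eq_or_ne i j with rfl | hi
      · rw [hd'j, hd'i _ (by omega), hj1]
        push_cast
        omega
      · rcases eq_or_ne (i + 1) j with rfl | hi'
        · rw [hd'j, hd'i _ hi]
          omega
        · rwa [hd'i _ hi, hd'i _ hi']
    have hsum : ∑ i ∈ Finset.range N, (d'.1 i - (M - i)) <
        ∑ i ∈ Finset.range N, (d.1 i - (M - i)) := by
      refine Finset.sum_lt_sum (fun i _ => ?_) ⟨j, Finset.mem_range.2 hjN, by rw [hd'j]; omega⟩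
      rcases eq_or_ne i j with rfl | hi
      · rw [hd'j]; omega
      · rw [hd'i i hi]
    rw [← ih d' hanti (fun i hi => by rw [hd'i i (by omega), hN i hi])
      (by push_cast at hlt; omega)]
    have hup : raise M (d.1 j - 1) (wedge d) = wedge d' := by
      rw [raise, sub_add_cancel, unitOp_wedge_apply _ hd.injective]
    have hdown : lower M (d.1 j - 1) (wedge d') = wedge d := by
      rw [lower, sub_add_cancel, ← hd'j, unitOp_wedge_apply _ hanti.injective, hd',
        Seq.replace_replace_same, Seq.replace_self]
    exact ⟨fun h => hup ▸ hr _ _ h, fun h => hdown ▸ hl _ _ h⟩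

theorem eq_bot_or_eq_top_of_preserves {W : Submodule ℂ (Fock M)}
    (hr : ∀ s, Preserves W (raise M s)) (hl : ∀ s, Preserves W (lower M s)) :
    W = ⊥ ∨ W = ⊤ := by
  have hvac : ∀ d : Seq M, StrictAnti d.1 → (wedge d ∈ W ↔ vac M ∈ W) := by
    intro d hd
    obtain ⟨N, hN⟩ := d.exists_eq
    refine wedge_mem_iff_vac_mem hr hl N
      ((∑ i ∈ Finset.range N, (d.1 i - (M - i))).toNat + 1) d hd hN ?_
    push_cast
    omega
  have hc : ∀ s, Preserves W (coroot M s) := fun s => by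
    rw [← lie_raise_lower_self]
    exact (hr s).lie (hl s)
  rw [or_iff_not_imp_left, Submodule.eq_bot_iff]
  intro h
  push Not at h
  obtain ⟨v, hv, hv0⟩ := h
  have hspan : v ∈ Submodule.span ℂ (wedge '' {d : Seq M | StrictAnti d.1}) := by
    rw [span_wedge_strictAnti]; trivial
  obtain ⟨c, hcs, rfl⟩ := (Finsupp.mem_span_image_iff_linearCombination ℂ).1 hspan
  rw [Finsupp.linearCombination_apply, Finsupp.sum] at hv hv0
  obtain ⟨d, hd, hdW⟩ := exists_wedge_mem (preserves_unitOp_self hc) c c.support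
    (fun d hd => (Finsupp.mem_supported ℂ c).1 hcs hd) hv hv0
  rw [eq_top_iff, ← span_wedge_strictAnti, Submodule.span_le]
  rintro _ ⟨d', hd', rfl⟩
  exact (hvac d' hd').2 ((hvac d hd).1 hdW)

/-! ### Irreducibility of every such action -/

theorem isIrreducible_of_forall {ρ : Tor n κ →ₐ[ℂ] Module.End ℂ (Fock M)}
    (h : ∀ W : Submodule ℂ (Fock M), (∀ a, Preserves W (ρ a)) → W = ⊥ ∨ W = ⊤) :
    IsIrreducible ρ := by
  let _ : Module (Tor n κ) (Fock M) := Module.compHom (Fock M) ρ.toRingHom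
  have hsmul : ∀ (a : Tor n κ) (v : Fock M), a • v = ρ a v := fun _ _ => rfl
  have hsimple : IsSimpleOrder (Submodule (Tor n κ) (Fock M)) :=
    { exists_pair_ne := ⟨⊥, ⊤, fun hbt => vac_ne_zero M <| by
        have : vac M ∈ (⊥ : Submodule (Tor n κ) (Fock M)) := by rw [hbt]; trivial
        exact (Submodule.mem_bot _).1 this⟩
      eq_bot_or_eq_top := fun W => by
        let W' : Submodule ℂ (Fock M) :=
          { W.toAddSubmonoid with
            smul_mem' := fun c v hv => by
              have h1 := W.smul_mem (algebraMap ℂ (Tor n κ) c) hv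
              rw [hsmul, AlgHom.commutes, Module.algebraMap_end_apply] at h1
              exact h1 }
        have hmem : ∀ v, v ∈ W' ↔ v ∈ W := fun _ => Iff.rfl
        refine (h W' fun a v hv => ?_).imp (fun hb => ?_) fun ht => ?_
        · exact (hmem _).2 (hsmul a v ▸ W.smul_mem a hv)
        · refine (Submodule.eq_bot_iff _).2 fun v hv => ?_
          rwa [← hmem, hb, Submodule.mem_bot] at hv
        · refine eq_top_iff.2 fun v _ => ?_
          rw [← hmem, ht]
          trivial }
  exact (isSimpleModule_iff _ _).2 hsimple

/-- Here `|p| ≠ 1` enters: it gives `|κ| ≠ 1`, so already the absolute values of the `x_s` are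
distinct. -/
theorem zpow_one_sub_injective {p : ℂ} (hn : n ≠ 0) (hp0 : p ≠ 0) (hp : ‖p‖ ≠ 1)
    (hκ : κ ^ n = p⁻¹) : Function.Injective fun s : ℤ => κ ^ (1 - s) := by
  have h1 : ‖κ‖ ≠ 1 := by
    intro h
    have := congrArg norm hκ
    rw [norm_pow, h, one_pow, norm_inv] at this
    exact hp (inv_eq_one.1 this.symm)
  have h0 : κ ≠ 0 := by
    rintro rfl
    rw [zero_pow hn] at hκ
    exact inv_ne_zero hp0 hκ.symm
  intro s t hst
  have h2 := congrArg norm hst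
  simp only [norm_zpow] at h2
  have := zpow_right_injective₀ (norm_pos_iff.2 h0) h1 h2
  omega

theorem isIrreducible_of_isFockAction (hn : 3 ≤ n) {p : ℂ} (hκ0 : κ ≠ 0)
    (hx : Function.Injective fun s : ℤ => κ ^ (1 - s)) (hκ : κ ^ n = p⁻¹)
    {ρ : Tor n κ →ₐ[ℂ] Module.End ℂ (Fock M)} (hρ : IsFockAction n p κ M ρ) :
    IsIrreducible ρ := by
  refine isIrreducible_of_forall fun W hW => ?_
  have h := preserves_raise_lower hn hκ0 hx (W := W)
    (fun i => (hρ.E i).unique (actsBy_raise hn i) ▸ hW _)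
    (fun i => (hρ.F i).unique (actsBy_lower hn i) ▸ hW _)
    (hρ.e0.unique (actsBy_vertE0 hn hκ) ▸ hW _)
  exact eq_bot_or_eq_top_of_preserves (fun s => (h s).1) fun s => (h s).2

end ToroidalFock

theorem mainTheorem5 (n : ℕ) (hn : 3 ≤ n) (M : ℤ) (p κ : ℂ) (hp0 : p ≠ 0) (hp : ‖p‖ ≠ 1)
    (hκ : κ ^ n = p⁻¹) :
    (∃ ρ : ToroidalFock.Tor n κ →ₐ[ℂ] Module.End ℂ (ToroidalFock.Fock M),
      ToroidalFock.IsFockAction n p κ M ρ) ∧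
    ∀ ρ : ToroidalFock.Tor n κ →ₐ[ℂ] Module.End ℂ (ToroidalFock.Fock M),
      ToroidalFock.IsFockAction n p κ M ρ → ToroidalFock.IsIrreducible ρ := by
  have hκ0 : κ ≠ 0 := by
    rintro rfl
    rw [zero_pow (by omega)] at hκ
    exact inv_ne_zero hp0 hκ.symm
  exact ⟨⟨_, ToroidalFock.isFockAction_fockAction hn hκ0 hκ⟩, fun ρ hρ =>
    ToroidalFock.isIrreducible_of_isFockAction hn hκ0
      (ToroidalFock.zpow_one_sub_injective (by omega) hp0 hp hκ) hκ hρ⟩
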